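/- **Setting.** A tensor network is a finite hypergraph: vertices are tensors, hyperedges are indices, and each hyperedge $e$ has a dimension size $\exp(w(e))\in\mathbb{N}_{\ge 1}$ and at least two ends, one of which may be free (dangling). For a vertex set $A$, let $E(A)$ be the set of hyperedges adjacent to $A$ that are also adjacent to a vertex outside $A$ or have a free end, and for disjoint $A,B$ let $E(A,B)$ be the set of hyperedges adjacent to both; $\mathrm{cut}(A)$ and $\mathrm{cut}(A,B)$ are the sums of $w$ over these sets. Contracting $A$ with $B$ costs $\exp(\mathrm{cut}(A)+\mathrm{cut}(B)-\mathrm{cut}(A,B))$, and a contraction tree (a rooted binary tree whose leaves are the vertices, each once) costs the sum of the costs of its contractions. The data network $G_D$ has vertex set $V_D$ and a set $\bar E$ of $N$ dangling edges to be sketched; each edge of $\bar E$ is adjacent to exactly one tensor, and each tensor to at most one edge of $\bar E$. A contraction tree $T_0$ of $G_D$ is given. An embedding $G_E$ is a graph with $N_E$ vertices; each edge of $\bar E$ joins the data to one embedding vertex, and every other embedding edge joins two distinct embedding vertices or is an output edge at one vertex. A contraction tree $T_B$ of $(G_D,G_E)$ is constrained on $T_0$ if for each contraction $(A,B)$ of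 $T_0$ there is a contraction $(\hat A,\hat B)$ of $T_B$ with $\hat A\cap V_D=A$ and $\hat B\cap V_D=B$. Fix $c_1,c_2>0$, and for $\epsilon>0$, $0<\delta<1$ put $\kappa=\log(1/\delta)/\epsilon^2$. Let $\mathcal{G}^{(\epsilon,\delta)}$ be the class of embeddings such that (i) for some ordering of the embedding vertices, at each vertex the product of the sizes of its output edges and of its edges to later vertices is at least $c_1N_E\kappa$; (ii) there is exactly one output edge, and its size, the sketch size, lies in $[c_1N_E\kappa,\;c_2N_E\kappa]$. **Algorithm 1** with sketch size $m$, when every data vertex is adjacent to an edge of $\bar E$. Each data tensor is contracted with its own matrix, adjacent to its edge in $\bar E$ (the Kronecker product embedding). Then for each contraction $(U,V)$ of $T_0$, in the order of $T_0$, a two-tensor network $Z$ is applied. With all quantities computed in the data network without $\bar E$, let $a=\exp(\mathrm{cut}(U)-\mathrm{cut}(U,V))$, $c=\exp(\mathrm{cut}(V)-\mathrm{cut}(U,V))$, $d=\exp(\mathrm{cut}(U\cup V))/(ac)$, $b=\exp(\mathrm{cut}(U,V))/d$; exchange $U$ and $V$ (and $a$ and $c$) if $a>c$. Put $\alpha=\min(m,\lceil\sqrt{mc/b}\,\rceil)$.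 The network $Z$ has tensors $v_1,v_2$ joined by an edge of size $m$. The sketched $U$, written $\hat U$, is connected to $v_1$ by an edge of size $m$; the sketched $V$, written $\hat V$, is connected to $v_1$ by an edge of size $\alpha$ and to $v_2$ by an edge of size $\lceil m/\alpha\rceil$. The output of $Z$ (or of a Kronecker matrix) leaves from $v_2$ (or from that matrix), and the contraction order is $(((\hat U,v_1),\hat V),v_2)$. The last tensor carries the output edge, of size $m$. This embedding has $3N-2$ vertices. **Theorem 4.2.** For all $c_1,c_2>0$ there is a constant $C>0$ such that the following holds for all $G_D$, $T_0$, $\epsilon>0$, $\delta\in(0,1)$ and integers $m\ge1$ with $c_1(3N-2)\kappa\le m\le c_2(3N-2)\kappa$. Suppose every vertex of $G_D$ is adjacent to an edge of $\bar E$, and every edge of $\bar E$ has size greater than $m$. Then the embedding of Algorithm 1 has sketch size $m$ and lies in $\mathcal{G}^{(\epsilon,\delta)}$, its contraction tree is a contraction tree of data and embedding constrained on $T_0$, and $$\mathrm{cost}(\text{Algorithm 1})\;\le\; C\cdot \mathrm{cost}(T_B)$$ for every $G_E\in\mathcal{G}^{(\epsilon,\delta)}$ with sketch size at least $c_1N\kappa$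 and every contraction tree $T_B$ of $(G_D,G_E)$ constrained on $T_0$. That is, Algorithm 1 has asymptotically optimal cost. -/

import Mathlib

namespace TNSketch

section

open scoped Classical

noncomputable section

/-- A (finite) tensor network on the vertex type `V`, given by a hypergraph with hyperedges `E`.
`ends e` is the set of tensors that share the index `e`, `dangling e` says that `e` has a free end
(an uncontracted index), and `dim e` is the dimension size of the index. Every hyperedge has at
least two ends, a free end counting as one. -/
structure TensorNetwork (V E : Type*) where
  ends : E → Finset V
  dangling : E → Prop
  dim : E → ℕ
  dim_pos : ∀ e, 0 < dim e
  ends_nonempty : ∀ e, (ends e).Nonempty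
  two_ends : ∀ e, ¬ dangling e → 2 ≤ (ends e).card

namespace TensorNetwork

variable {V E : Type*} [Fintype E] (G : TensorNetwork V E)

/-- `w(e)`, the natural logarithm of the dimension size. -/
def weight (e : E) : ℝ := Real.log (G.dim e)

/-- `E(A, B)`: the hyperedges adjacent to both `A` and `B`. -/
def edgesBetween (A B : Finset V) : Finset E :=
  Finset.univ.filter fun e => (∃ v ∈ G.ends e, v ∈ A) ∧ ∃ v ∈ G.ends e, v ∈ B

/-- `E(A)`: the hyperedges adjacent to `A` that also have an end outside `A`, either a vertex
outside `A` or a free end. These are the indices of the tensor obtained by contracting `A`. -/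
def edgesOf (A : Finset V) : Finset E :=
  Finset.univ.filter fun e =>
    (∃ v ∈ G.ends e, v ∈ A) ∧ ((∃ v ∈ G.ends e, v ∉ A) ∨ G.dangling e)

/-- `cut(A)`. -/
def cut (A : Finset V) : ℝ := ∑ e ∈ G.edgesOf A, G.weight e

/-- `cut(A, B)`. -/
def cutBetween (A B : Finset V) : ℝ := ∑ e ∈ G.edgesBetween A B, G.weight e

/-- The cost (up to a constant factor) of contracting the tensor of `A` with the tensor of `B`, for
disjoint `A` and `B`, by dense classical matrix multiplication. -/
def contractionCost (A B : Finset V) : ℝ :=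
  Real.exp (G.cut A + G.cut B - G.cutBetween A B)

end TensorNetwork

/-- Rooted binary trees with leaves labelled by `V`. -/
inductive ContractionTree (V : Type*) where
  | leaf (v : V) : ContractionTree V
  | node (l r : ContractionTree V) : ContractionTree V

namespace ContractionTree

variable {V : Type*}

/-- The labels of the leaves, from left to right. -/
def leaves : ContractionTree V → List V
  | leaf v => [v]
  | node l r => l.leaves ++ r.leaves

/-- The set of vertices that have been contracted at the root of the tree. -/
def verts (t : ContractionTree V) : Finset V := t.leaves.toFinset

/-- `t` is a contraction tree of a tensor network with vertex type `V`: every vertex is the label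
of exactly one leaf. -/
def IsFull (t : ContractionTree V) : Prop := t.leaves.Nodup ∧ ∀ v : V, v ∈ t.leaves

/-- The list of contractions `(A, B)` performed by the tree, one for each internal vertex. -/
def contractions : ContractionTree V → List (Finset V × Finset V)
  | leaf _ => []
  | node l r => (l.verts, r.verts) :: (l.contractions ++ r.contractions)

/-- The cost of a contraction tree: the sum of the costs of its contractions. -/
def cost {E : Type*} [Fintype E] (G : TensorNetwork V E) (t : ContractionTree V) : ℝ :=
  (t.contractions.map fun p => G.contractionCost p.1 p.2).sum

/-- `W ∩ V_D` for a set `W` of data and embedding vertices. -/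
def dataPart {VE : Type*} (W : Finset (V ⊕ VE)) : Finset V :=
  W.preimage Sum.inl Sum.inl_injective.injOn

/-- The contraction tree `T` of the data and the embedding is constrained on the contraction tree
`T₀` of the data: for every contraction `(A, B)` of `T₀` there is a contraction `(A', B')` of `T`
(contractions being unordered pairs) with `A' ∩ V_D = A` and `B' ∩ V_D = B`. -/
def ConstrainedOn {VE : Type*} (T : ContractionTree (V ⊕ VE)) (T₀ : ContractionTree V) : Prop :=
  ∀ p ∈ T₀.contractions, ∃ q ∈ T.contractions,
    (dataPart q.1 = p.1 ∧ dataPart q.2 = p.2) ∨ (dataPart q.1 = p.2 ∧ dataPart q.2 = p.1)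

end ContractionTree

/-- A data tensor network. `S` is the set of edges to be sketched, and `E` the set of all the other
hyperedges; `rest` is the network without the edges to be sketched. An edge to be sketched is
adjacent to only one tensor, and a tensor to at most one edge to be sketched. -/
structure DataNetwork (V E S : Type*) where
  rest : TensorNetwork V E
  vertex : S → V
  vertex_injective : Function.Injective vertex
  size : S → ℕ
  size_pos : ∀ s, 0 < size s

/-- A tensor network embedding for the edges `S` to be sketched, with graph structure. Besides the
edges in `S`, of which `s` is adjacent to the embedding vertex `input s`, it has edges `EE`, each
adjacent to two vertices (contracted) or to one vertex (uncontracted). -/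
structure Embedding (S VE EE : Type*) where
  input : S → VE
  ends : EE → Finset VE
  ends_card : ∀ f, (ends f).card = 1 ∨ (ends f).card = 2
  dim : EE → ℕ
  dim_pos : ∀ f, 0 < dim f

namespace Embedding

variable {S VE EE : Type*} [Fintype VE] [Fintype EE] (F : Embedding S VE EE)

/-- The uncontracted edges (output dimensions) of the embedding, other than those in `S`. -/
def outputs : Finset EE := Finset.univ.filter fun f => (F.ends f).card = 1

/-- The output sketch size. -/
def sketchSize : ℕ := ∏ f ∈ F.outputs, F.dim f

/-- The row size of the matricization of the tensor at `v`, for the ordering `ord` of the embedding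
vertices: the rows consist of the uncontracted dimensions at `v` and of the dimensions contracted
with a tensor of higher index. -/
def rowSize (ord : VE → ℕ) (v : VE) : ℕ :=
  ∏ f ∈ Finset.univ.filter
    (fun f => v ∈ F.ends f ∧ ((F.ends f).card = 1 ∨ ∃ u ∈ F.ends f, ord v < ord u)), F.dim f

end Embedding

/-- `n log(1/δ) / ε²`. -/
def scale (ε δ n : ℝ) : ℝ := n * Real.log (1 / δ) / ε ^ 2

namespace Embedding

variable {S VE EE : Type*} [Fintype VE] [Fintype EE] (F : Embedding S VE EE)

/-- The sufficient condition for `(ε, δ)`-accuracy, with constant `c`: in some linearization every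
row size is at least `c N_E log(1/δ) / ε²`, where `N_E` is the number of embedding vertices. -/
def SufficientlyAccurate (c ε δ : ℝ) : Prop :=
  ∃ ord : VE → ℕ, Function.Injective ord ∧
    ∀ v, c * scale ε δ (Fintype.card VE) ≤ F.rowSize ord v

/-- The class of embeddings that satisfy the sufficient condition and have only one output
dimension, of size `m = Θ(N_E log(1/δ) / ε²)`; `c₁` and `c₂` are the constants in the asymptotic
lower and upper bounds. -/
structure InClass (c₁ c₂ ε δ : ℝ) : Prop where
  one_output : F.outputs.card = 1
  accurate : F.SufficientlyAccurate c₁ ε δ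
  sketchSize_ge : c₁ * scale ε δ (Fintype.card VE) ≤ F.sketchSize
  sketchSize_le : (F.sketchSize : ℝ) ≤ c₂ * scale ε δ (Fintype.card VE)

end Embedding

namespace DataNetwork

variable {V E S : Type*} [Fintype E] (D : DataNetwork V E S)

/-- The overall tensor network of the data and the embedding. -/
def withEmbedding {VE EE : Type*} (F : Embedding S VE EE) :
    TensorNetwork (V ⊕ VE) (E ⊕ S ⊕ EE) where
  ends
    | .inl e => (D.rest.ends e).map Function.Embedding.inl
    | .inr (.inl s) => {Sum.inl (D.vertex s), Sum.inr (F.input s)}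
    | .inr (.inr f) => (F.ends f).map Function.Embedding.inr
  dangling
    | .inl e => D.rest.dangling e
    | .inr (.inl _) => False
    | .inr (.inr f) => (F.ends f).card = 1
  dim
    | .inl e => D.rest.dim e
    | .inr (.inl s) => D.size s
    | .inr (.inr f) => F.dim f
  dim_pos
    | .inl e => D.rest.dim_pos e
    | .inr (.inl s) => D.size_pos s
    | .inr (.inr f) => F.dim_pos f
  ends_nonempty
    | .inl e => by simpa using D.rest.ends_nonempty e
    | .inr (.inl s) => by simp
    | .inr (.inr f) => by
        rw [Finset.map_nonempty, ← Finset.card_pos]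
        rcases F.ends_card f with h | h <;> omega
  two_ends
    | .inl e => fun h => by simpa using D.rest.two_ends e h
    | .inr (.inl s) => fun _ => by simp
    | .inr (.inr f) => fun h => by
        rw [Finset.card_map]
        rcases F.ends_card f with h' | h'
        · exact absurd h' h
        · omega

/-- For a contraction `(A, B)` of the data, the size of the dimensions of `A` outside the edges to
be sketched that are not adjacent to `B`. For `(A, B) = (U_i, V_i)` this is `a_i`, and for
`(A, B) = (V_i, U_i)` it is `c_i`. -/
def outerSize (A B : Finset V) : ℝ := Real.exp (D.rest.cut A - D.rest.cutBetween A B)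

/-- `d_i`: the size of the dimensions adjacent to both `A` and `B` that remain after the
contraction. -/
def sharedSize (A B : Finset V) : ℝ :=
  Real.exp (D.rest.cut (A ∪ B)) / (D.outerSize A B * D.outerSize B A)

/-- `b_i`: the size of the dimensions contracted between `A` and `B`. -/
def contractedSize (A B : Finset V) : ℝ :=
  Real.exp (D.rest.cutBetween A B) / D.sharedSize A B

/-- The size `α` of the edge between the sketched `B` and the tensor that is applied to the
sketched `A`: the minimizer `√(m c / b)` of `a b d m² α + a c d m³ / α`, rounded up to an integer
and cut off at `m`. -/
def splitSize (m : ℕ) (A B : Finset V) : ℕ :=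
  min m ⌈Real.sqrt (m * D.outerSize B A / D.contractedSize A B)⌉₊

/-- The size `m / α`, rounded up, of the other edge that carries the sketch dimension of `B`. -/
def cosplitSize (m : ℕ) (A B : Finset V) : ℕ := ⌈(m : ℝ) / D.splitSize m A B⌉₊

lemma splitSize_pos {m : ℕ} (hm : 0 < m) (A B : Finset V) : 0 < D.splitSize m A B := by
  have hm' : (0 : ℝ) < m := Nat.cast_pos.mpr hm
  refine lt_min hm (Nat.ceil_pos.mpr (Real.sqrt_pos.mpr ?_))
  simp only [outerSize, contractedSize, sharedSize]
  positivity

lemma cosplitSize_pos {m : ℕ} (hm : 0 < m) (A B : Finset V) : 0 < D.cosplitSize m A B :=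
  Nat.ceil_pos.mpr
    (div_pos (Nat.cast_pos.mpr hm) (Nat.cast_pos.mpr (D.splitSize_pos hm A B)))

end DataNetwork

namespace ContractionTree

variable {V : Type*}

/-- The type of the contractions (internal vertices) of a tree; `none` is the one at the root. -/
def Contraction : ContractionTree V → Type
  | leaf _ => Empty
  | node l r => Option (l.Contraction ⊕ r.Contraction)

instance instFintypeContraction : (t : ContractionTree V) → Fintype t.Contraction
  | leaf _ => inferInstanceAs (Fintype Empty)
  | node l r =>
    letI := instFintypeContraction l
    letI := instFintypeContraction r
    inferInstanceAs (Fintype (Option (l.Contraction ⊕ r.Contraction)))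

/-- The vertex of the tree that is its root: a leaf or a contraction. -/
def root : (t : ContractionTree V) → V ⊕ t.Contraction
  | leaf v => .inl v
  | node _ _ => .inr none

/-- A vertex of the left subtree as a vertex of the whole tree. -/
def ofLeft {l r : ContractionTree V} : V ⊕ l.Contraction → V ⊕ (node l r).Contraction :=
  Sum.map id fun i => some (.inl i)

/-- A vertex of the right subtree as a vertex of the whole tree. -/
def ofRight {l r : ContractionTree V} : V ⊕ r.Contraction → V ⊕ (node l r).Contraction :=
  Sum.map id fun i => some (.inr i)

/-- The left child of a contraction. -/
def leftChild : (t : ContractionTree V) → t.Contraction → V ⊕ t.Contraction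
  | leaf _, i => Empty.elim i
  | node l _, none => ofLeft l.root
  | node l _, some (.inl i) => ofLeft (l.leftChild i)
  | node _ r, some (.inr i) => ofRight (r.leftChild i)

/-- The right child of a contraction. -/
def rightChild : (t : ContractionTree V) → t.Contraction → V ⊕ t.Contraction
  | leaf _, i => Empty.elim i
  | node _ r, none => ofRight r.root
  | node l _, some (.inl i) => ofLeft (l.rightChild i)
  | node _ r, some (.inr i) => ofRight (r.rightChild i)

/-- The set `U_i` of data vertices below the left child of the contraction `i`. -/
def leftVerts : (t : ContractionTree V) → t.Contraction → Finset V
  | leaf _, i => Empty.elim i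
  | node l _, none => l.verts
  | node l _, some (.inl i) => l.leftVerts i
  | node _ r, some (.inr i) => r.leftVerts i

/-- The set `V_i` of data vertices below the right child of the contraction `i`. -/
def rightVerts : (t : ContractionTree V) → t.Contraction → Finset V
  | leaf _, i => Empty.elim i
  | node _ r, none => r.verts
  | node l _, some (.inl i) => l.rightVerts i
  | node _ r, some (.inr i) => r.rightVerts i

lemma ofLeft_ne {l r : ContractionTree V} {x : V ⊕ l.Contraction} {i : l.Contraction}
    (h : x ≠ .inr i) : ofLeft (r := r) x ≠ .inr (some (.inl i)) := by
  rintro h'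
  rcases x with v | j
  · exact Sum.inl_ne_inr h'
  · exact h (congrArg Sum.inr (Sum.inl_injective (Option.some_injective _ (Sum.inr_injective h'))))

lemma ofRight_ne {l r : ContractionTree V} {x : V ⊕ r.Contraction} {i : r.Contraction}
    (h : x ≠ .inr i) : ofRight (l := l) x ≠ .inr (some (.inr i)) := by
  rintro h'
  rcases x with v | j
  · exact Sum.inl_ne_inr h'
  · exact h (congrArg Sum.inr (Sum.inr_injective (Option.some_injective _ (Sum.inr_injective h'))))

lemma ofLeft_ne_none {l r : ContractionTree V} (x : V ⊕ l.Contraction) :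
    ofLeft (r := r) x ≠ .inr none := by
  rintro h'
  rcases x with v | j
  · exact Sum.inl_ne_inr h'
  · exact Option.some_ne_none _ (Sum.inr_injective h')

lemma ofRight_ne_none {l r : ContractionTree V} (x : V ⊕ r.Contraction) :
    ofRight (l := l) x ≠ .inr none := by
  rintro h'
  rcases x with v | j
  · exact Sum.inl_ne_inr h'
  · exact Option.some_ne_none _ (Sum.inr_injective h')

lemma leftChild_ne : ∀ (t : ContractionTree V) (i : t.Contraction), t.leftChild i ≠ .inr i
  | leaf _, i => Empty.elim i
  | node _ _, none => ofLeft_ne_none _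
  | node l _, some (.inl i) => ofLeft_ne (l.leftChild_ne i)
  | node _ r, some (.inr i) => ofRight_ne (r.leftChild_ne i)

lemma rightChild_ne : ∀ (t : ContractionTree V) (i : t.Contraction), t.rightChild i ≠ .inr i
  | leaf _, i => Empty.elim i
  | node _ _, none => ofRight_ne_none _
  | node l _, some (.inl i) => ofLeft_ne (l.rightChild_ne i)
  | node _ r, some (.inr i) => ofRight_ne (r.rightChild_ne i)

end ContractionTree

namespace Alg

/-- The embedding vertices of the algorithm: a Kronecker factor (a matrix) for every edge to be
sketched, and for every contraction `i` of the data contraction tree a small network `Z_i` of the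
two tensors `(i, 0)` and `(i, 1)`, the first and the last one that are applied. `X` is the type of
the contractions. -/
abbrev Vertex (S X : Type*) := S ⊕ (X × Fin 2)

/-- The embedding edges of the algorithm: the output edge `none`, and four edges for every small
network. -/
abbrev Edge (X : Type*) := Option (X × Fin 4)

section

variable {V E S : Type*} [Fintype E] (D : DataNetwork V E S)
  (hD : Function.Surjective D.vertex)

/-- The edge to be sketched that is adjacent to the data vertex `v`. -/
def edgeAt (v : V) : S := Function.surjInv hD v

/-- The embedding tensor that carries the output sketch dimension of a vertex of the data
contraction tree: the Kronecker factor for a leaf, the last tensor of `Z_i` for the contraction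
`i`. -/
def outTensor {X : Type*} : V ⊕ X → Vertex S X
  | .inl v => .inl (edgeAt D hD v)
  | .inr i => .inr (i, 1)

/-- Whether in the contraction of `A` and `B` the operand `A` is sketched first: `a_i ≤ c_i`. -/
def LeftFirst (A B : Finset V) : Prop := D.outerSize A B ≤ D.outerSize B A

variable (T : ContractionTree V)

/-- The operand of the contraction `i` that is sketched first. -/
def firstChild (i : T.Contraction) : V ⊕ T.Contraction :=
  if LeftFirst D (T.leftVerts i) (T.rightVerts i) then T.leftChild i else T.rightChild i

/-- The other operand of the contraction `i`. -/
def secondChild (i : T.Contraction) : V ⊕ T.Contraction :=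
  if LeftFirst D (T.leftVerts i) (T.rightVerts i) then T.rightChild i else T.leftChild i

/-- The data vertices of the first operand. -/
def firstVerts (i : T.Contraction) : Finset V :=
  if LeftFirst D (T.leftVerts i) (T.rightVerts i) then T.leftVerts i else T.rightVerts i

/-- The data vertices of the second operand. -/
def secondVerts (i : T.Contraction) : Finset V :=
  if LeftFirst D (T.leftVerts i) (T.rightVerts i) then T.rightVerts i else T.leftVerts i

lemma outTensor_secondChild_ne (i : T.Contraction) :
    outTensor D hD (secondChild D T i) ≠ .inr (i, 1) := by
  have h : secondChild D T i ≠ .inr i := by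
    unfold secondChild
    split_ifs
    · exact T.rightChild_ne i
    · exact T.leftChild_ne i
  rcases hc : secondChild D T i with v | j
  · simp [outTensor]
  · rw [hc] at h
    simpa [outTensor] using h

/-- The embedding of the algorithm with sketch size `m`. For the contraction `i` with sketched
operands `P` (first) and `Q` (second), `Z_i` consists of the tensors `(i, 0)` and `(i, 1)`, joined
by an edge of size `m`; the sketch dimension of `P` is an edge of size `m` to `(i, 0)`; the sketch
dimension of `Q` is split into an edge of size `α` to `(i, 0)` and one of size `⌈m / α⌉` to
`(i, 1)`. The output edge is at the last tensor of all. -/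
def embedding (m : ℕ) (hm : 0 < m) :
    Embedding S (Vertex S T.Contraction) (Edge T.Contraction) where
  input s := .inl s
  ends
    | none => {outTensor D hD T.root}
    | some (i, 0) => {outTensor D hD (firstChild D T i), .inr (i, 0)}
    | some (i, 1) => {outTensor D hD (secondChild D T i), .inr (i, 0)}
    | some (i, 2) => {outTensor D hD (secondChild D T i), .inr (i, 1)}
    | some (i, 3) => {.inr (i, 0), .inr (i, 1)}
  ends_card
    | none => .inl (Finset.card_singleton _)
    | some (i, 0) => .inr (Finset.card_pair (by
        rcases firstChild D T i with v | j <;> simp [outTensor]))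
    | some (i, 1) => .inr (Finset.card_pair (by
        rcases secondChild D T i with v | j <;> simp [outTensor]))
    | some (i, 2) => .inr (Finset.card_pair (outTensor_secondChild_ne D hD T i))
    | some (i, 3) => .inr (Finset.card_pair (by simp))
  dim
    | none => m
    | some (_, 0) => m
    | some (i, 1) => D.splitSize m (firstVerts D T i) (secondVerts D T i)
    | some (i, 2) => D.cosplitSize m (firstVerts D T i) (secondVerts D T i)
    | some (_, 3) => m
  dim_pos
    | none => hm
    | some (_, 0) => hm
    | some (_, 1) => D.splitSize_pos hm _ _
    | some (_, 2) => D.cosplitSize_pos hm _ _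
    | some (_, 3) => hm

open ContractionTree in
/-- The part of the sketching contraction tree for a subtree of the data contraction tree, `f`
being the inclusion of the contractions of the subtree into those of the whole tree. A data tensor
is contracted with its Kronecker factor; a contraction of the data with sketched operands `P`
(first) and `Q` (second) becomes `(((P, (i, 0)), Q), (i, 1))`. -/
def treeAux {X : Type*} : (t : ContractionTree V) → (t.Contraction → X) →
    ContractionTree (V ⊕ Vertex S X)
  | leaf v, _ => node (leaf (.inl v)) (leaf (.inr (.inl (edgeAt D hD v))))
  | node l r, f =>
    let L := treeAux l fun i => f (some (.inl i))
    let R := treeAux r fun i => f (some (.inr i))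
    let z : Fin 2 → ContractionTree (V ⊕ Vertex S X) := fun k => leaf (.inr (.inr (f none, k)))
    if LeftFirst D l.verts r.verts then node (node (node L (z 0)) R) (z 1)
    else node (node (node R (z 0)) L) (z 1)

/-- The sketching contraction tree of the algorithm. -/
def tree : ContractionTree (V ⊕ Vertex S T.Contraction) := treeAux D hD T id

end

end Alg

end

end

end TNSketch

/-! The cost of contracting disjoint sets A and B is the product of the sizes of the indices in E(A)
∪ E(B) (`contractionCost_eq`), so a lower bound on a contraction only requires exhibiting many
indices in this union.

Lower bound. Put the data tensors first and the embedding tensors after them, in the order supplied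
by the accuracy condition. Every tensor then has a row of edges that are dangling or lead to later
tensors; the rows are disjoint and have size at least km, where k depends only on c₁ and c₂
(`rowSystem`). The row of the last tensor of a set leaves that set (`row_subset_edgesOf`), so each
operand of a contraction brings a factor km on top of the data indices.

Take a contraction (A, B) whose data parts are those of a contraction of T₀, with last tensors x of
A and y of B, y not after x. Split the row of y into the part of size t adjacent to A and the
remaining part of size u, so that tu ≥ km. Let b and d be the contracted and the shared size of the
data parts, p and q their outer sizes (of A and of B), so that pq = ac. Three contractions are
compared. The contraction (A, B) itself costs at least pqbd(km)². The contraction forming A costs at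
least pbd(km)²t, since the t-part leaves A (`le_formingCost`). The contraction consuming A ∪ B costs
at least pqd(km)²u (`le_consumingCost`). If a neighbour is missing, the bound attributed to it
follows from the first one (`exists_le_cost`).

The geometric mean of the last two bounds eliminates t and u and leaves d√(pabc(km)⁵). The algorithm
spends abdm²α and, up to rounding, acdm³/α; the choice α ≈ √(mc/b) balances both at d√(a²bcm⁵).
Sketching the operand with the smaller outer size first makes a ≤ p whichever operand contains x.
This comparison, with the cases where α is cut off at 1 or m, is `stageCost_le`.

Distinct contractions of T₀ use distinct contractions of T_B, and a contraction lies in at most four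
such neighbourhoods, so the bounds add up with a loss of 4 (`sum_neighborCost_le`). The initial
contractions with Kronecker factors are charged separately, to the contraction that first consumes
each data tensor (`sum_leafCost_le`).

Upper bound. In the algorithm's tree, the only embedding edges leaving the part that belongs to a
subtree of T₀ are those carrying the sketch of its root (`mem_outEdges_of_mem_edgesOf`). The indices
of every intermediate tensor are therefore known, and `cost_tree_le` follows. -/

namespace TNSketch

section

open scoped Classical

/-! ### Contraction costs as products over sets of indices -/

namespace TensorNetwork

variable {V E : Type*} (G : TensorNetwork V E)

lemma exp_sum_weight (s : Finset E) :
    Real.exp (∑ e ∈ s, G.weight e) = ∏ e ∈ s, (G.dim e : ℝ) := by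
  rw [Real.exp_sum]
  refine Finset.prod_congr rfl fun e _ => ?_
  rw [weight, Real.exp_log (Nat.cast_pos.mpr (G.dim_pos e))]

lemma one_le_prod_dim (s : Finset E) : (1 : ℝ) ≤ ∏ e ∈ s, (G.dim e : ℝ) := by
  rw [← Nat.cast_prod]
  exact_mod_cast Finset.prod_pos fun e _ => G.dim_pos e

lemma prod_dim_mono {s t : Finset E} (h : s ⊆ t) :
    ∏ e ∈ s, (G.dim e : ℝ) ≤ ∏ e ∈ t, (G.dim e : ℝ) := by
  rw [← Nat.cast_prod, ← Nat.cast_prod]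
  exact_mod_cast Nat.le_of_dvd (Finset.prod_pos fun e _ => G.dim_pos e)
    (Finset.prod_dvd_prod_of_subset _ _ _ h)

variable [Fintype E]

lemma exp_cut (A : Finset V) : Real.exp (G.cut A) = ∏ e ∈ G.edgesOf A, (G.dim e : ℝ) :=
  G.exp_sum_weight _

lemma edgesBetween_comm (A B : Finset V) : G.edgesBetween A B = G.edgesBetween B A := by
  ext e
  simp [edgesBetween, and_comm]

lemma contractionCost_comm (A B : Finset V) :
    G.contractionCost A B = G.contractionCost B A := by
  rw [contractionCost, contractionCost, cutBetween, cutBetween, edgesBetween_comm,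
    add_comm (G.cut A)]

/-- By disjointness, an index adjacent to both sets has an end outside each of them, so the
condition of leaving the set is automatic. -/
lemma edgesBetween_eq [DecidableEq E] {A B : Finset V} (h : Disjoint A B) :
    G.edgesBetween A B = G.edgesOf A ∩ G.edgesOf B := by
  ext e
  simp only [edgesBetween, edgesOf, Finset.mem_filter, Finset.mem_univ, true_and,
    Finset.mem_inter]
  constructor
  · rintro ⟨⟨v, hv, hA⟩, ⟨w, hw, hB⟩⟩
    exact ⟨⟨⟨v, hv, hA⟩, .inl ⟨w, hw, fun h' => Finset.disjoint_left.mp h h' hB⟩⟩,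
      ⟨⟨w, hw, hB⟩, .inl ⟨v, hv, fun h' => Finset.disjoint_left.mp h hA h'⟩⟩⟩
  · rintro ⟨⟨hA, -⟩, ⟨hB, -⟩⟩
    exact ⟨hA, hB⟩

/-- Inclusion–exclusion: subtracting cut(A, B) counts each common index once. All later cost
estimates become inclusions between sets of indices. -/
lemma contractionCost_eq [DecidableEq E] {A B : Finset V} (h : Disjoint A B) :
    G.contractionCost A B = ∏ e ∈ G.edgesOf A ∪ G.edgesOf B, (G.dim e : ℝ) := by
  rw [contractionCost, ← exp_sum_weight, cut, cut, cutBetween, edgesBetween_eq G h,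
    ← Finset.sum_union_inter]
  congr 1
  ring

lemma contractionCost_pos (A B : Finset V) : 0 < G.contractionCost A B := Real.exp_pos _

lemma prod_le_contractionCost [DecidableEq E] {A B : Finset V} (h : Disjoint A B) {s : Finset E}
    (hs : s ⊆ G.edgesOf A ∪ G.edgesOf B) :
    ∏ e ∈ s, (G.dim e : ℝ) ≤ G.contractionCost A B := by
  rw [contractionCost_eq G h]
  exact G.prod_dim_mono hs

lemma mem_edgesOf {A : Finset V} {e : E} : e ∈ G.edgesOf A ↔
    (∃ v ∈ G.ends e, v ∈ A) ∧ ((∃ v ∈ G.ends e, v ∉ A) ∨ G.dangling e) := by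
  simp [edgesOf]

lemma edgesOf_union_subset [DecidableEq V] [DecidableEq E] (A B : Finset V) :
    G.edgesOf (A ∪ B) ⊆ G.edgesOf A ∪ G.edgesOf B := by
  intro e
  simp only [Finset.mem_union, mem_edgesOf]
  rintro ⟨⟨v, hv, hAB⟩, h⟩
  have hA : ∀ C ⊆ A ∪ B, (∃ v ∈ G.ends e, v ∉ C) ∨ G.dangling e := fun C hC =>
    h.imp (fun ⟨w, hw, hw'⟩ => ⟨w, hw, fun h' =>
      hw' (Finset.mem_union.mp (hC h'))⟩) id
  rcases hAB with hv' | hv'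
  · exact .inl ⟨⟨v, hv, hv'⟩, hA _ Finset.subset_union_left⟩
  · exact .inr ⟨⟨v, hv, hv'⟩, hA _ Finset.subset_union_right⟩

end TensorNetwork

/-! ### Contraction trees and the neighbourhoods of their contractions -/

namespace ContractionTree

variable {V E : Type*} [Fintype E] (G : TensorNetwork V E)

lemma leaves_ne_nil : ∀ t : ContractionTree V, t.leaves ≠ []
  | leaf _ => by simp [leaves]
  | node l r => by simp [leaves, leaves_ne_nil l]

lemma mem_verts {t : ContractionTree V} {v : V} : v ∈ t.verts ↔ v ∈ t.leaves :=
  List.mem_toFinset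

lemma verts_nonempty (t : ContractionTree V) : t.verts.Nonempty := by
  simpa [verts] using t.leaves_ne_nil

lemma verts_node [DecidableEq V] (l r : ContractionTree V) : (node l r).verts = l.verts ∪ r.verts
    := by
  ext v
  simp [verts, leaves]

lemma verts_leaf (v : V) : (leaf v).verts = {v} := by
  simp [verts, leaves]

lemma nodup_node {l r : ContractionTree V} (h : (node l r).leaves.Nodup) :
    l.leaves.Nodup ∧ r.leaves.Nodup ∧ Disjoint l.verts r.verts := by
  rw [leaves, List.nodup_append'] at h
  refine ⟨h.1, h.2.1, ?_⟩
  rw [Finset.disjoint_left]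
  intro a ha hb
  exact h.2.2 (by simpa [verts] using ha) (by simpa [verts] using hb)

lemma cost_leaf (v : V) : (leaf v).cost G = 0 := by simp [cost, contractions]

lemma cost_node (l r : ContractionTree V) :
    (node l r).cost G = G.contractionCost l.verts r.verts + (l.cost G + r.cost G) := by
  simp [cost, contractions]

lemma cost_nonneg : ∀ t : ContractionTree V, 0 ≤ t.cost G
  | leaf _ => by simp [cost_leaf]
  | node l r => by
      have := cost_nonneg l
      have := cost_nonneg r
      have := G.contractionCost_pos l.verts r.verts
      rw [cost_node]
      positivity

lemma sum_node {l r : ContractionTree V} (f : (node l r).Contraction → ℝ) :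
    ∑ i, f i = f none + (∑ i, f (some (.inl i)) + ∑ i, f (some (.inr i))) :=
  (Fintype.sum_option (α := l.Contraction ⊕ r.Contraction) f).trans
    (congrArg _ (Fintype.sum_sum_type _))

lemma card_contraction : ∀ t : ContractionTree V,
    Fintype.card t.Contraction + 1 = t.leaves.length
  | leaf _ => rfl
  | node l r => by
      have h : Fintype.card (node l r).Contraction =
          Fintype.card l.Contraction + Fintype.card r.Contraction + 1 :=
        (Fintype.card_option (α := l.Contraction ⊕ r.Contraction)).trans
          (congrArg (· + 1) Fintype.card_sum)
      rw [h, leaves, List.length_append, ← card_contraction l, ← card_contraction r]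
      omega

lemma sum_contractions (g : Finset V × Finset V → ℝ) : ∀ t : ContractionTree V,
    (t.contractions.map g).sum = ∑ i : t.Contraction, g (t.leftVerts i, t.rightVerts i)
  | leaf _ => rfl
  | node l r => by
      rw [sum_node, contractions, List.map_cons, List.sum_cons, List.map_append,
        List.sum_append, sum_contractions g l, sum_contractions g r]
      rfl

lemma mem_contractions_iff {p : Finset V × Finset V} : ∀ {t : ContractionTree V},
    p ∈ t.contractions ↔ ∃ i, p = (t.leftVerts i, t.rightVerts i)
  | leaf _ => ⟨fun h => by simp [contractions] at h, fun ⟨i, _⟩ => Empty.elim i⟩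
  | node l r => by
      rw [contractions, List.mem_cons, List.mem_append, mem_contractions_iff,
        mem_contractions_iff]
      constructor
      · rintro (h | ⟨i, h⟩ | ⟨i, h⟩)
        · exact ⟨none, h⟩
        · exact ⟨some (.inl i), h⟩
        · exact ⟨some (.inr i), h⟩
      · rintro ⟨_ | i | i, h⟩
        · exact .inl h
        · exact .inr (.inl ⟨i, h⟩)
        · exact .inr (.inr ⟨i, h⟩)

lemma leftVerts_nonempty : ∀ (t : ContractionTree V) (i : t.Contraction),
    (t.leftVerts i).Nonempty
  | leaf _, i => Empty.elim i
  | node l _, none => l.verts_nonempty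
  | node l _, some (.inl i) => l.leftVerts_nonempty i
  | node _ r, some (.inr i) => r.leftVerts_nonempty i

lemma rightVerts_nonempty : ∀ (t : ContractionTree V) (i : t.Contraction),
    (t.rightVerts i).Nonempty
  | leaf _, i => Empty.elim i
  | node _ r, none => r.verts_nonempty
  | node l _, some (.inl i) => l.rightVerts_nonempty i
  | node _ r, some (.inr i) => r.rightVerts_nonempty i

lemma leftVerts_union_rightVerts_subset [DecidableEq V] : ∀ (t : ContractionTree V)
    (i : t.Contraction),
    t.leftVerts i ∪ t.rightVerts i ⊆ t.verts
  | leaf _, i => Empty.elim i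
  | node l r, none => (verts_node l r).ge
  | node l r, some (.inl i) => (l.leftVerts_union_rightVerts_subset i).trans
      (by rw [verts_node]; exact Finset.subset_union_left)
  | node l r, some (.inr i) => (r.leftVerts_union_rightVerts_subset i).trans
      (by rw [verts_node]; exact Finset.subset_union_right)

lemma disjoint_leftVerts_rightVerts : ∀ (t : ContractionTree V), t.leaves.Nodup →
    ∀ i : t.Contraction, Disjoint (t.leftVerts i) (t.rightVerts i)
  | leaf _, _, i => Empty.elim i
  | node _ _, h, none => (nodup_node h).2.2
  | node l _, h, some (.inl i) => l.disjoint_leftVerts_rightVerts (nodup_node h).1 i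
  | node _ r, h, some (.inr i) => r.disjoint_leftVerts_rightVerts (nodup_node h).2.1 i

/-- A contraction is determined by the set of vertices that it has contracted. -/
lemma leftVerts_union_rightVerts_injective [DecidableEq V] : ∀ (t : ContractionTree V),
    t.leaves.Nodup →
    Function.Injective fun i : t.Contraction => t.leftVerts i ∪ t.rightVerts i
  | leaf _, _ => fun i => Empty.elim i
  | node l r, h => by
      obtain ⟨hl, hr, hd⟩ := nodup_node h
      -- Contractions in different places of the tree are told apart by a nonempty set that one
      -- union contains and the other is disjoint from.
      have ne (s t u : Finset V) (hs : s ⊆ t) (ht : Disjoint t u) (hu : u.Nonempty) :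
          ¬ u ⊆ s := fun h' => by
        obtain ⟨x, hx⟩ := hu
        exact Finset.disjoint_left.mp ht (hs (h' hx)) hx
      have hL := l.leftVerts_union_rightVerts_subset
      have hR := r.leftVerts_union_rightVerts_subset
      have nR : ∀ i, (r.leftVerts i ∪ r.rightVerts i).Nonempty := fun i =>
        (r.leftVerts_nonempty i).mono Finset.subset_union_left
      have nL : ∀ i, (l.leftVerts i ∪ l.rightVerts i).Nonempty := fun i =>
        (l.leftVerts_nonempty i).mono Finset.subset_union_left
      rintro (_ | i | i) (_ | j | j) hij
      · rfl
      · change l.verts ∪ r.verts = l.leftVerts j ∪ l.rightVerts j at hij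
        exact (ne _ _ _ (hL j) hd r.verts_nonempty
          (hij ▸ Finset.subset_union_right)).elim
      · change l.verts ∪ r.verts = r.leftVerts j ∪ r.rightVerts j at hij
        exact (ne _ _ _ (hR j) hd.symm l.verts_nonempty
          (hij ▸ Finset.subset_union_left)).elim
      · change l.leftVerts i ∪ l.rightVerts i = l.verts ∪ r.verts at hij
        exact (ne _ _ _ (hL i) hd r.verts_nonempty
          (hij ▸ Finset.subset_union_right)).elim
      · exact congrArg (some ∘ Sum.inl) (l.leftVerts_union_rightVerts_injective hl hij)
      · change l.leftVerts i ∪ l.rightVerts i = r.leftVerts j ∪ r.rightVerts j at hij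
        exact (ne _ _ _ (hL i) (hd.mono_right (hR j)) (nR j) hij.ge).elim
      · change r.leftVerts i ∪ r.rightVerts i = l.verts ∪ r.verts at hij
        exact (ne _ _ _ (hR i) hd.symm l.verts_nonempty
          (hij ▸ Finset.subset_union_left)).elim
      · change r.leftVerts i ∪ r.rightVerts i = l.leftVerts j ∪ l.rightVerts j at hij
        exact (ne _ _ _ (hR i) (hd.symm.mono_right (hL j)) (nL j) hij.ge).elim
      · exact congrArg (some ∘ Sum.inr) (r.leftVerts_union_rightVerts_injective hr hij)

/-- The cost of the last contraction of a tree. -/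
noncomputable def topCost : ContractionTree V → ℝ
  | leaf _ => 0
  | node l r => G.contractionCost l.verts r.verts

lemma topCost_nonneg : ∀ t : ContractionTree V, 0 ≤ t.topCost G
  | leaf _ => le_rfl
  | node l r => (G.contractionCost_pos l.verts r.verts).le

/-- The total cost of a contraction, of the contractions that form its operands, and of the one
that consumes its result, which is taken to be `π` at the root. -/
noncomputable def neighborCost : ℝ → (t : ContractionTree V) → t.Contraction → ℝ
  | _, leaf _, i => Empty.elim i
  | π, node l r, none => G.contractionCost l.verts r.verts + l.topCost G + r.topCost G + π
  | _, node l r, some (.inl i) => neighborCost (G.contractionCost l.verts r.verts) l i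
  | _, node l r, some (.inr i) => neighborCost (G.contractionCost l.verts r.verts) r i

lemma neighborCost_nonneg : ∀ (π : ℝ), 0 ≤ π → ∀ (t : ContractionTree V) (i : t.Contraction),
    0 ≤ neighborCost G π t i
  | _, _, leaf _, i => Empty.elim i
  | π, hπ, node l r, none => by
      have := G.contractionCost_pos l.verts r.verts
      have := l.topCost_nonneg G
      have := r.topCost_nonneg G
      simp only [neighborCost]
      positivity
  | _, _, node l r, some (.inl i) =>
      neighborCost_nonneg _ (G.contractionCost_pos l.verts r.verts).le l i
  | _, _, node l r, some (.inr i) =>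
      neighborCost_nonneg _ (G.contractionCost_pos l.verts r.verts).le r i

/-- A contraction is counted once for itself, once by the contraction that takes its result as an
operand, and at most twice as the consumer of its own operands. The top contraction has no parent in
the tree, which accounts for the subtracted term and makes the induction close. -/
lemma sum_neighborCost_le : ∀ (t : ContractionTree V) (π : ℝ), 0 ≤ π →
    ∑ i, neighborCost G π t i ≤ 4 * t.cost G - t.topCost G + π
  | leaf v, π, hπ => by
      have h : ∑ i, neighborCost G π (leaf v) i = 0 := Finset.sum_empty
      simpa [h, cost_leaf, topCost] using hπ
  | node l r, π, hπ => by
      have hc := (G.contractionCost_pos l.verts r.verts).le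
      have h₁ := sum_neighborCost_le l _ hc
      have h₂ := sum_neighborCost_le r _ hc
      rw [sum_node, cost_node]
      change G.contractionCost l.verts r.verts + l.topCost G + r.topCost G + π +
        (∑ i, neighborCost G (G.contractionCost l.verts r.verts) l i +
          ∑ i, neighborCost G (G.contractionCost l.verts r.verts) r i) ≤
        _ - G.contractionCost l.verts r.verts + π
      linarith

/-- `a` is the cost of forming the tensor of `A` from two tensors, or `A` is a single tensor. -/
def IsFormingCost [DecidableEq V] (A : Finset V) (a : ℝ) : Prop :=
  (∃ x, A = {x} ∧ a = 0) ∨ ∃ A₁ A₂ : Finset V, A₁.Nonempty ∧ A₂.Nonempty ∧ Disjoint A₁ A₂ ∧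
    A₁ ∪ A₂ = A ∧ a = G.contractionCost A₁ A₂

lemma isFormingCost_nonneg [DecidableEq V] {G : TensorNetwork V E} {A : Finset V} {a : ℝ}
    (h : IsFormingCost G A a) : 0 ≤ a := by
  rcases h with ⟨_, _, rfl⟩ | ⟨_, _, _, _, _, _, rfl⟩
  · exact le_rfl
  · exact (G.contractionCost_pos _ _).le

lemma isFormingCost_topCost [DecidableEq V] : ∀ t : ContractionTree V, t.leaves.Nodup →
    IsFormingCost G t.verts (t.topCost G)
  | leaf v, _ => .inl ⟨v, verts_leaf v, rfl⟩
  | node l r, h => .inr ⟨l.verts, r.verts, l.verts_nonempty, r.verts_nonempty,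
      (nodup_node h).2.2, (verts_node l r).symm, rfl⟩

/-- Turns the recursive definition into costs of contractions of explicit sets. The consuming
contraction pairs the result with the vertex set of the sibling subtree; only at the root is it
replaced by the placeholder `π`. -/
lemma neighborCost_spec [DecidableEq V] : ∀ (t : ContractionTree V), t.leaves.Nodup → ∀ (π : ℝ)
    (i : t.Contraction), ∃ a b c, neighborCost G π t i =
      G.contractionCost (t.leftVerts i) (t.rightVerts i) + a + b + c ∧
      IsFormingCost G (t.leftVerts i) a ∧ IsFormingCost G (t.rightVerts i) b ∧
      ((t.leftVerts i ∪ t.rightVerts i = t.verts ∧ c = π) ∨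
        ∃ R : Finset V, R.Nonempty ∧ Disjoint (t.leftVerts i ∪ t.rightVerts i) R ∧
          c = G.contractionCost (t.leftVerts i ∪ t.rightVerts i) R)
  | leaf _, _, _, i => Empty.elim i
  | node l r, h, π, none => ⟨_, _, _, rfl, isFormingCost_topCost G l (nodup_node h).1,
      isFormingCost_topCost G r (nodup_node h).2.1, .inl ⟨(verts_node l r).symm, rfl⟩⟩
  | node l r, h, π, some (.inl i) => by
      obtain ⟨a, b, c, habc, ha, hb, hc⟩ := neighborCost_spec l (nodup_node h).1
        (G.contractionCost l.verts r.verts) i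
      refine ⟨a, b, c, habc, ha, hb, .inr ?_⟩
      rcases hc with ⟨hv, hc⟩ | hR
      · refine ⟨r.verts, r.verts_nonempty, ?_, ?_⟩
        · change Disjoint (l.leftVerts i ∪ l.rightVerts i) _
          rw [hv]
          exact (nodup_node h).2.2
        · change c = G.contractionCost (l.leftVerts i ∪ l.rightVerts i) _
          rw [hv, hc]
      · exact hR
  | node l r, h, π, some (.inr i) => by
      obtain ⟨a, b, c, habc, ha, hb, hc⟩ := neighborCost_spec r (nodup_node h).2.1
        (G.contractionCost l.verts r.verts) i
      refine ⟨a, b, c, habc, ha, hb, .inr ?_⟩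
      rcases hc with ⟨hv, hc⟩ | hR
      · refine ⟨l.verts, l.verts_nonempty, ?_, ?_⟩
        · change Disjoint (r.leftVerts i ∪ r.rightVerts i) _
          rw [hv]
          exact (nodup_node h).2.2.symm
        · change c = G.contractionCost (r.leftVerts i ∪ r.rightVerts i) _
          rw [hv, hc, G.contractionCost_comm]
      · exact hR

/-- If the weight of every single tensor is at most the cost of each of its contractions, then the
total weight is at most twice the cost of the tree. -/
lemma sum_leaves_le (g : V → ℝ)
    (hg : ∀ x (B : Finset V), B.Nonempty → Disjoint {x} B → g x ≤ G.contractionCost {x} B) :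
    ∀ l r : ContractionTree V, (node l r).leaves.Nodup →
      ((node l r).leaves.map g).sum ≤ 2 * (node l r).cost G := by
  -- The induction needs a contraction that consumes the whole subtree, since a single leaf is paid
  -- for by the contraction consuming it. Each contraction has two operands, hence the factor 2.
  have key : ∀ t : ContractionTree V, t.leaves.Nodup → ∀ B : Finset V, B.Nonempty →
      Disjoint t.verts B →
      (t.leaves.map g).sum ≤ 2 * t.cost G + G.contractionCost t.verts B := by
    intro t
    induction t with
    | leaf v =>
      intro _ B hB hd
      rw [verts_leaf] at hd ⊢
      simpa [leaves, cost_leaf] using hg v B hB hd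
    | node l r ihl ihr =>
      intro h B _ _
      obtain ⟨hl, hr, hd⟩ := nodup_node h
      have h₁ := ihl hl _ r.verts_nonempty hd
      have h₂ := ihr hr _ l.verts_nonempty hd.symm
      rw [G.contractionCost_comm] at h₂
      have h₃ := G.contractionCost_pos (node l r).verts B
      rw [leaves, List.map_append, List.sum_append, cost_node]
      linarith
  intro l r h
  obtain ⟨hl, hr, hd⟩ := nodup_node h
  have h₁ := key l hl _ r.verts_nonempty hd
  have h₂ := key r hr _ l.verts_nonempty hd.symm
  rw [G.contractionCost_comm] at h₂
  rw [leaves, List.map_append, List.sum_append, cost_node]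
  linarith

end ContractionTree

/-! ### Lower bounds on contractions from disjoint rows -/

namespace TensorNetwork

/-- A linearization of the tensors of `G` in which every tensor `x` is given a set `row x` of
edges, each uncontracted or contracted with a later tensor, of total size at least `κ`. -/
structure RowSystem {W E : Type*} (G : TensorNetwork W E) (κ : ℝ) where
  ord : W → ℕ
  row : W → Finset E
  mem_ends : ∀ x, ∀ e ∈ row x, x ∈ G.ends e
  exits : ∀ x, ∀ e ∈ row x, G.dangling e ∨ ∃ y ∈ G.ends e, ord x < ord y
  disjoint_row : ∀ x y, x ≠ y → Disjoint (row x) (row y)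
  le_prod : ∀ x, κ ≤ ∏ e ∈ row x, (G.dim e : ℝ)
  dangling_unique : ∀ x y, ∀ e ∈ row x, ∀ f ∈ row y, G.dangling e → G.dangling f → e = f

namespace RowSystem

variable {W E : Type*} {G : TensorNetwork W E} {κ : ℝ} (R : RowSystem G κ)

lemma exists_last {A : Finset W} (hA : A.Nonempty) : ∃ x ∈ A, ∀ y ∈ A, R.ord y ≤ R.ord x :=
  A.exists_max_image R.ord hA

/-- The edges in the row of `y` that are adjacent to `A`. -/
noncomputable def rowTo (y : W) (A : Finset W) : Finset E :=
  (R.row y).filter fun e => ∃ v ∈ G.ends e, v ∈ A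

/-- The edges in the row of `y` that are not adjacent to `A`. -/
noncomputable def rowAway (y : W) (A : Finset W) : Finset E :=
  (R.row y).filter fun e => ¬ ∃ v ∈ G.ends e, v ∈ A

lemma mem_rowTo {y : W} {A : Finset W} {e : E} :
    e ∈ R.rowTo y A ↔ e ∈ R.row y ∧ ∃ v ∈ G.ends e, v ∈ A :=
  Finset.mem_filter

lemma mem_rowAway {y : W} {A : Finset W} {e : E} :
    e ∈ R.rowAway y A ↔ e ∈ R.row y ∧ ¬ ∃ v ∈ G.ends e, v ∈ A :=
  Finset.mem_filter

lemma rowTo_subset (y : W) (A : Finset W) : R.rowTo y A ⊆ R.row y := Finset.filter_subset _ _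

lemma rowAway_subset (y : W) (A : Finset W) : R.rowAway y A ⊆ R.row y := Finset.filter_subset _ _

lemma le_rowTo_mul_rowAway (y : W) (A : Finset W) :
    κ ≤ (∏ e ∈ R.rowTo y A, (G.dim e : ℝ)) * ∏ e ∈ R.rowAway y A, (G.dim e : ℝ) := by
  rw [rowTo, rowAway, Finset.prod_filter_mul_prod_filter_not]
  exact R.le_prod y

/-- The later end of such an edge is not in `A`, by choice of the edge, nor in `B`, where `y` is
last. -/
lemma rowAway_exits [DecidableEq W] {A B : Finset W} {y : W} (hyB : ∀ z ∈ B, R.ord z ≤ R.ord y)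
    {e : E} (he : e ∈ R.rowAway y A) : (∃ v ∈ G.ends e, v ∉ A ∪ B) ∨ G.dangling e := by
  obtain ⟨her, hA⟩ := R.mem_rowAway.mp he
  rcases R.exits y e her with h | ⟨z, hz, hlt⟩
  · exact .inr h
  · refine .inl ⟨z, hz, fun h => ?_⟩
    rcases Finset.mem_union.mp h with h | h
    · exact hA ⟨z, hz, h⟩
    · exact (hyB z h).not_gt hlt

/-- This handles the root, where no contraction consumes the result. An edge of the row of `y` that
avoids `A` would have to dangle; but the last tensor `x` of the network can only have dangling edges
in its row, and there is just one dangling edge to share. -/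
lemma rowAway_eq_empty [DecidableEq W] {A B : Finset W} {x y : W} (hAB : Disjoint A B)
    (hx : x ∈ A) (hy : y ∈ B)
    (hxA : ∀ z ∈ A, R.ord z ≤ R.ord x) (hyB : ∀ z ∈ B, R.ord z ≤ R.ord y)
    (hyx : R.ord y ≤ R.ord x) (huniv : ∀ w, w ∈ A ∪ B) (hκ : 1 < κ) :
    R.rowAway y A = ∅ := by
  by_contra hne
  obtain ⟨e, he⟩ := Finset.nonempty_iff_ne_empty.mpr hne
  have her := R.rowAway_subset _ _ he
  have hed : G.dangling e :=
    (R.rowAway_exits hyB he).resolve_left fun ⟨v, _, hv⟩ => hv (huniv v)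
  -- A member of the row of `x` would coincide with `e`, which lies in the disjoint row of `y`. An
  -- empty row has product 1, contradicting `1 < κ`.
  have hxrow : R.row x = ∅ := by
    refine Finset.eq_empty_of_forall_notMem fun f hf => ?_
    have hfd : G.dangling f := by
      refine (R.exits x f hf).resolve_right fun ⟨w, _, hw⟩ => hw.not_ge ?_
      exact (Finset.mem_union.mp (huniv w)).elim (hxA w) fun h => (hyB w h).trans hyx
    have hef := R.dangling_unique x y f hf e her hfd hed
    refine Finset.disjoint_left.mp (R.disjoint_row x y ?_) hf (hef ▸ her)
    rintro rfl
    exact Finset.disjoint_left.mp hAB hx hy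
  have := R.le_prod x
  rw [hxrow, Finset.prod_empty] at this
  linarith

variable [Fintype E]

/-- The source of every factor `κ`: edges to tensors later than the last tensor of `A` have an end
outside `A`. -/
lemma row_subset_edgesOf {A : Finset W} {x : W} (hx : x ∈ A)
    (hmax : ∀ y ∈ A, R.ord y ≤ R.ord x) : R.row x ⊆ G.edgesOf A := by
  intro e he
  rw [mem_edgesOf]
  refine ⟨⟨x, R.mem_ends x e he, hx⟩, ?_⟩
  rcases R.exits x e he with h | ⟨y, hy, hlt⟩
  · exact .inr h
  · exact .inl ⟨y, hy, fun hyA => (hmax y hyA).not_gt hlt⟩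

/-- The common form of the bounds for the neighbouring contractions: `X` will be the data indices,
`x` and `z` the last tensors of the two operands, and `Y` the part of a third row that is also
present. Disjointness allows the products to be multiplied. -/
lemma prod_mul_prod_le [DecidableEq E] (hκ : 0 ≤ κ) {A B : Finset W} (hAB : Disjoint A B)
    {X Y : Finset E}
    {x z : W} (hxz : x ≠ z) (hX : X ⊆ G.edgesOf A ∪ G.edgesOf B)
    (hY : Y ⊆ G.edgesOf A ∪ G.edgesOf B) (hx : R.row x ⊆ G.edgesOf A ∪ G.edgesOf B)
    (hz : R.row z ⊆ G.edgesOf A ∪ G.edgesOf B) (hXrow : ∀ w, Disjoint X (R.row w))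
    {y : W} (hYrow : Y ⊆ R.row y) (hyx : y ≠ x) (hyz : y ≠ z) :
    (∏ e ∈ X, (G.dim e : ℝ)) * (κ ^ 2 * ∏ e ∈ Y, (G.dim e : ℝ)) ≤ G.contractionCost A B := by
  have hu := G.prod_le_contractionCost hAB (s := X ∪ ((R.row x ∪ R.row z) ∪ Y))
    (Finset.union_subset hX (Finset.union_subset (Finset.union_subset hx hz) hY))
  rw [Finset.prod_union, Finset.prod_union, Finset.prod_union] at hu
  · refine le_trans ?_ hu
    have h₁ := R.le_prod x
    have h₂ := R.le_prod z
    have := zero_le_one.trans (G.one_le_prod_dim X)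
    have := zero_le_one.trans (G.one_le_prod_dim Y)
    rw [sq]
    gcongr
  · exact R.disjoint_row _ _ hxz
  · exact (Finset.disjoint_union_left.mpr
      ⟨R.disjoint_row _ _ hyx.symm, R.disjoint_row _ _ hyz.symm⟩).mono_right hYrow
  · exact Finset.disjoint_union_right.mpr
      ⟨Finset.disjoint_union_right.mpr ⟨hXrow x, hXrow z⟩, (hXrow y).mono_right hYrow⟩

section

variable {A B : Finset W} {x y : W} {X : Finset E}

lemma le_mainCost [DecidableEq E] (hAB : Disjoint A B) (hx : x ∈ A) (hy : y ∈ B)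
    (hxA : ∀ z ∈ A, R.ord z ≤ R.ord x) (hyB : ∀ z ∈ B, R.ord z ≤ R.ord y)
    (hXrow : ∀ w, Disjoint X (R.row w)) (hκ : 0 ≤ κ) (hX : X ⊆ G.edgesOf A ∪ G.edgesOf B) :
    (∏ e ∈ X, (G.dim e : ℝ)) * κ ^ 2 ≤ G.contractionCost A B := by
  have hu := G.prod_le_contractionCost hAB (s := X ∪ (R.row x ∪ R.row y))
    (Finset.union_subset hX (Finset.union_subset_union (R.row_subset_edgesOf hx hxA)
      (R.row_subset_edgesOf hy hyB)))
  rw [Finset.prod_union, Finset.prod_union] at hu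
  · refine le_trans ?_ hu
    have h₁ := R.le_prod x
    have h₂ := R.le_prod y
    have := zero_le_one.trans (G.one_le_prod_dim X)
    rw [sq]
    gcongr
  · exact R.disjoint_row _ _ fun h => Finset.disjoint_left.mp hAB hx (h ▸ hy)
  · exact Finset.disjoint_union_right.mpr ⟨hXrow x, hXrow y⟩

/-- Both halves of `A` contribute the row of their last tensor, one of these being `x`. The edges
from `y` to `A` are indices of `A` because `y` lies outside, so they already appear when `A` is
formed. -/
lemma le_formingCost [DecidableEq W] (hAB : Disjoint A B) (hx : x ∈ A) (hy : y ∈ B)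
    (hxA : ∀ z ∈ A, R.ord z ≤ R.ord x)
    (hXrow : ∀ w, Disjoint X (R.row w)) (hκ : 0 ≤ κ) {A₁ A₂ : Finset W} (h₁ : A₁.Nonempty)
    (h₂ : A₂.Nonempty) (hd : Disjoint A₁ A₂) (hA : A₁ ∪ A₂ = A) (hX : X ⊆ G.edgesOf A) :
    (∏ e ∈ X, (G.dim e : ℝ)) * (κ ^ 2 * ∏ e ∈ R.rowTo y A, (G.dim e : ℝ)) ≤
      G.contractionCost A₁ A₂ := by
  -- The two halves play symmetric roles.
  wlog hx₂ : x ∈ A₂ generalizing A₁ A₂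
  · rw [G.contractionCost_comm]
    refine this h₂ h₁ hd.symm (by rw [Finset.union_comm, hA]) ?_
    rw [← hA, Finset.mem_union] at hx
    tauto
  obtain ⟨z, hz, hzmax⟩ := R.exists_last h₁
  have hyA : y ∉ A := fun h => Finset.disjoint_left.mp hAB h hy
  have hzA : z ∈ A := hA ▸ Finset.mem_union_left _ hz
  refine R.prod_mul_prod_le hκ hd (x := x) (z := z) (y := y) ?_ (fun e he => ?_) (fun e he => ?_)
    ((R.row_subset_edgesOf hx₂ fun w hw => hxA w (hA ▸ Finset.mem_union_right _ hw)).trans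
      Finset.subset_union_right)
    ((R.row_subset_edgesOf hz hzmax).trans Finset.subset_union_left)
    hXrow (R.rowTo_subset _ _) ?_ ?_
  · rintro rfl
    exact Finset.disjoint_left.mp hd hz hx₂
  · exact G.edgesOf_union_subset _ _ (hA ▸ hX he)
  · obtain ⟨her, v, hv, hvA⟩ := R.mem_rowTo.mp he
    refine G.edgesOf_union_subset _ _ ?_
    rw [hA, mem_edgesOf]
    exact ⟨⟨v, hv, hvA⟩, .inl ⟨y, R.mem_ends y e her, hyA⟩⟩
  · rintro rfl
    exact hyA hx
  · rintro rfl
    exact hyA hzA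

/-- Since `y` is not after `x`, the tensor `x` is last in `A ∪ B`, so its row survives the
contraction. The part of the row of `y` that avoids `A` survives as well, and `C` contributes the
row of its own last tensor. -/
lemma le_consumingCost [DecidableEq W] (hAB : Disjoint A B) (hx : x ∈ A) (hy : y ∈ B)
    (hxA : ∀ z ∈ A, R.ord z ≤ R.ord x) (hyB : ∀ z ∈ B, R.ord z ≤ R.ord y)
    (hyx : R.ord y ≤ R.ord x) (hXrow : ∀ w, Disjoint X (R.row w)) (hκ : 0 ≤ κ)
    {C : Finset W} (hC : C.Nonempty) (hd : Disjoint (A ∪ B) C) (hX : X ⊆ G.edgesOf (A ∪ B)) :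
    (∏ e ∈ X, (G.dim e : ℝ)) * (κ ^ 2 * ∏ e ∈ R.rowAway y A, (G.dim e : ℝ)) ≤
      G.contractionCost (A ∪ B) C := by
  obtain ⟨z, hz, hzmax⟩ := R.exists_last hC
  have hzne : ∀ w ∈ A ∪ B, w ≠ z := fun w hw h => Finset.disjoint_left.mp hd hw (h ▸ hz)
  refine R.prod_mul_prod_le hκ hd (x := x) (z := z) (y := y)
    (hzne _ (Finset.mem_union_left _ hx))
    (hX.trans Finset.subset_union_left) (fun e he => ?_)
    ((R.row_subset_edgesOf (Finset.mem_union_left _ hx) fun w hw => ?_).trans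
      Finset.subset_union_left)
    ((R.row_subset_edgesOf hz hzmax).trans Finset.subset_union_right)
    hXrow (R.rowAway_subset _ _) ?_ (hzne _ (Finset.mem_union_right _ hy))
  · refine Finset.mem_union_left _ ((G.mem_edgesOf).mpr ⟨⟨y, R.mem_ends y e
      (R.rowAway_subset _ _ he), Finset.mem_union_right _ hy⟩, R.rowAway_exits hyB he⟩)
  · exact (Finset.mem_union.mp hw).elim (hxA w) fun h => (hyB w h).trans hyx
  · rintro rfl
    exact Finset.disjoint_left.mp hAB hx hy

end

end RowSystem

end TensorNetwork

/-! ### The sizes a, b, c, d of a data contraction -/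

namespace DataNetwork

variable {V E S : Type*} (D : DataNetwork V E S) {A B : Finset V}

/-- A set of edges of the data as a set of edges of the data and the embedding. -/
def dataEdges (S EE : Type*) (X : Finset E) : Finset (E ⊕ S ⊕ EE) :=
  X.map Function.Embedding.inl

lemma prod_dataEdges {VE EE : Type*} (F : Embedding S VE EE) (X : Finset E) :
    ∏ e ∈ dataEdges S EE X, ((D.withEmbedding F).dim e : ℝ) = ∏ e ∈ X, (D.rest.dim e : ℝ) := by
  rw [dataEdges, Finset.prod_map]
  rfl

variable [Fintype E]

lemma sharedSize_comm (A B : Finset V) : D.sharedSize A B = D.sharedSize B A := by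
  rw [sharedSize, sharedSize, Finset.union_comm, mul_comm]

lemma contractedSize_comm (A B : Finset V) : D.contractedSize A B = D.contractedSize B A := by
  rw [contractedSize, contractedSize, sharedSize_comm, TensorNetwork.cutBetween,
    TensorNetwork.cutBetween, TensorNetwork.edgesBetween_comm]

lemma sharedSize_pos (A B : Finset V) : 0 < D.sharedSize A B := by
  simp only [outerSize, sharedSize]
  positivity

lemma outerSize_pos (A B : Finset V) : 0 < D.outerSize A B := Real.exp_pos _

lemma exp_cutBetween_eq (A B : Finset V) :
    Real.exp (D.rest.cutBetween A B) = D.contractedSize A B * D.sharedSize A B := by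
  rw [contractedSize, div_mul_cancel₀ _ (D.sharedSize_pos A B).ne']

lemma exp_cut_eq (A B : Finset V) : Real.exp (D.rest.cut A) =
    D.outerSize A B * D.contractedSize A B * D.sharedSize A B := by
  rw [mul_assoc, ← exp_cutBetween_eq, outerSize, ← Real.exp_add, sub_add_cancel]

lemma exp_cut_union_eq (A B : Finset V) : Real.exp (D.rest.cut (A ∪ B)) =
    D.outerSize A B * D.outerSize B A * D.sharedSize A B := by
  have := D.outerSize_pos A B
  have := D.outerSize_pos B A
  rw [sharedSize]
  field_simp

lemma contractionCost_rest_eq (A B : Finset V) : D.rest.contractionCost A B =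
    D.outerSize A B * D.outerSize B A * D.contractedSize A B * D.sharedSize A B := by
  rw [mul_assoc, ← exp_cutBetween_eq, outerSize, outerSize, TensorNetwork.cutBetween,
    TensorNetwork.cutBetween, D.rest.edgesBetween_comm B A, ← Real.exp_add, ← Real.exp_add,
    TensorNetwork.contractionCost, TensorNetwork.cutBetween]
  congr 1
  ring

lemma one_le_outerSize (h : Disjoint A B) : 1 ≤ D.outerSize A B := by
  rw [outerSize, Real.one_le_exp_iff, sub_nonneg, ← Real.exp_le_exp, D.rest.exp_cut,
    TensorNetwork.cutBetween, D.rest.exp_sum_weight, D.rest.edgesBetween_eq h]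
  exact D.rest.prod_dim_mono Finset.inter_subset_left

/-- An index of `A ∪ B` is an index of `A` or of `B`; in terms of the sizes this says acd ≤ abcd. -/
lemma one_le_contractedSize (h : Disjoint A B) : 1 ≤ D.contractedSize A B := by
  have h₁ : Real.exp (D.rest.cut (A ∪ B)) ≤ D.rest.contractionCost A B := by
    rw [D.rest.exp_cut, D.rest.contractionCost_eq h]
    exact D.rest.prod_dim_mono (D.rest.edgesOf_union_subset A B)
  rw [exp_cut_union_eq, contractionCost_rest_eq] at h₁
  have ha := D.outerSize_pos A B
  have hc := D.outerSize_pos B A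
  have hd := D.sharedSize_pos A B
  by_contra! hlt
  have h₂ : 0 < D.outerSize A B * D.outerSize B A * D.sharedSize A B := by positivity
  nlinarith

/-- The cost of the three contractions of the algorithm, up to a factor of two in the last one, for
the data contraction of `A` and `B`, where `A` is sketched first. -/
noncomputable def stageCost (m : ℕ) (A B : Finset V) : ℝ :=
  D.outerSize A B * D.contractedSize A B * D.sharedSize A B * (m * D.splitSize m A B * m) +
  D.rest.contractionCost A B * (D.splitSize m A B * D.cosplitSize m A B * m) +
  D.outerSize A B * D.outerSize B A * D.sharedSize A B * (D.cosplitSize m A B * m * (2 * m))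

variable {VE EE : Type*} (F : Embedding S VE EE)

lemma inl_mem_edgesOf [Fintype S] [Fintype EE] {A : Finset (V ⊕ VE)} {e : E} :
    Sum.inl e ∈ (D.withEmbedding F).edgesOf A ↔
      e ∈ D.rest.edgesOf (ContractionTree.dataPart A) := by
  simp [TensorNetwork.mem_edgesOf, withEmbedding, ContractionTree.dataPart]

lemma dataEdges_subset_edgesOf [Fintype S] [Fintype EE] {A : Finset (V ⊕ VE)} :
    dataEdges S EE (D.rest.edgesOf (ContractionTree.dataPart A)) ⊆
      (D.withEmbedding F).edgesOf A := by
  intro e he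
  obtain ⟨f, hf, rfl⟩ := Finset.mem_map.mp he
  exact (D.inl_mem_edgesOf F).mpr hf

end DataNetwork

namespace ContractionTree

variable {V VE : Type*}

lemma mem_dataPart {A : Finset (V ⊕ VE)} {v : V} : v ∈ dataPart A ↔ Sum.inl v ∈ A := by
  simp [dataPart]

lemma dataPart_union [DecidableEq V] [DecidableEq (V ⊕ VE)] (A B : Finset (V ⊕ VE)) :
    dataPart (A ∪ B) = dataPart A ∪ dataPart B := by
  ext v
  simp [mem_dataPart]

lemma disjoint_dataPart {A B : Finset (V ⊕ VE)} (h : Disjoint A B) :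
    Disjoint (dataPart A) (dataPart B) := by
  rw [Finset.disjoint_left] at h ⊢
  intro v hv hw
  exact h (mem_dataPart.mp hv) (mem_dataPart.mp hw)

end ContractionTree

lemma le_two_mul_of_le_ceil {x : ℝ} (h : 1 ≤ x) : (⌈x⌉₊ : ℝ) ≤ 2 * x := by
  have := Nat.ceil_lt_add_one (zero_le_one.trans h)
  linarith

/-! ### Cost of one stage of the algorithm against the lower bounds -/

namespace DataNetwork

open ContractionTree

variable {V E S : Type*} [Fintype E] (D : DataNetwork V E S) {A B : Finset V}

lemma splitSize_le (m : ℕ) (A B : Finset V) : D.splitSize m A B ≤ m := min_le_left _ _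

/-- Since α ≤ m, the quotient m/α is at least 1, so rounding it up at most doubles it. -/
lemma splitSize_mul_cosplitSize_le {m : ℕ} (hm : 0 < m) (A B : Finset V) :
    (D.splitSize m A B * D.cosplitSize m A B : ℝ) ≤ 2 * m := by
  have hα : (0 : ℝ) < D.splitSize m A B := Nat.cast_pos.mpr (D.splitSize_pos hm A B)
  have hle : (D.splitSize m A B : ℝ) ≤ m := Nat.cast_le.mpr (D.splitSize_le m A B)
  have h : (D.cosplitSize m A B : ℝ) ≤ 2 * (m / D.splitSize m A B) :=
    le_two_mul_of_le_ceil ((one_le_div hα).mpr hle)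
  calc (D.splitSize m A B * D.cosplitSize m A B : ℝ)
      ≤ D.splitSize m A B * (2 * (m / D.splitSize m A B)) := by gcongr
    _ = 2 * m := by field_simp

lemma le_splitSize_mul_cosplitSize {m : ℕ} (hm : 0 < m) (A B : Finset V) :
    m ≤ D.splitSize m A B * D.cosplitSize m A B := by
  have hα : (0 : ℝ) < D.splitSize m A B := Nat.cast_pos.mpr (D.splitSize_pos hm A B)
  have h : (m / D.splitSize m A B : ℝ) ≤ D.cosplitSize m A B := Nat.le_ceil _
  rw [div_le_iff₀ hα] at h
  rw [mul_comm]
  exact_mod_cast h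

/-- The cost of the algorithm for one contraction, compared with the lower bounds on the costs of
the contractions of another tree. -/
lemma stageCost_le {m : ℕ} (hm : 0 < m) (hAB : Disjoint A B)
    {k p q t u L : ℝ} (hk : 0 < k) (hk1 : k ≤ 1)
    (hap : D.outerSize A B ≤ p) (hpq : p * q = D.outerSize A B * D.outerSize B A)
    (hu : 0 ≤ u) (htu : k * m ≤ t * u)
    (h₁ : p * D.contractedSize A B * D.sharedSize A B * ((k * m) ^ 2 * t) ≤ L)
    (h₂ : p * q * D.sharedSize A B * ((k * m) ^ 2 * u) ≤ L)
    (h₃ : p * q * D.contractedSize A B * D.sharedSize A B * (k * m) ^ 2 ≤ L) :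
    k ^ 3 * D.stageCost m A B ≤ 8 * L := by
  have hα : (0 : ℝ) < D.splitSize m A B := Nat.cast_pos.mpr (D.splitSize_pos hm A B)
  have hαβ := D.splitSize_mul_cosplitSize_le hm A B
  rw [stageCost, contractionCost_rest_eq]
  have ha := D.one_le_outerSize hAB
  have hc := D.one_le_outerSize hAB.symm
  have hb := D.one_le_contractedSize hAB
  have hd := D.sharedSize_pos A B
  have hm1 : (1 : ℝ) ≤ m := by exact_mod_cast hm
  set β : ℝ := (D.cosplitSize m A B : ℝ)
  have hsplit : (D.splitSize m A B : ℝ) = min (m : ℝ)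
      (⌈Real.sqrt (m * D.outerSize B A / D.contractedSize A B)⌉₊ : ℝ) := by
    rw [splitSize, Nat.cast_min]
  set α : ℝ := (D.splitSize m A B : ℝ)
  rw [hpq] at h₂ h₃
  set a := D.outerSize A B
  set c := D.outerSize B A
  set b := D.contractedSize A B
  set d := D.sharedSize A B
  set ρ := Real.sqrt (m * c / b)
  have hρ : ρ ^ 2 = m * c / b := Real.sq_sqrt (by positivity)
  have hρb : ρ ^ 2 * b = m * c := by rw [hρ]; field_simp
  have hρ0 : 0 ≤ ρ := Real.sqrt_nonneg _
  -- The bound from the contraction itself, which always pays for the middle contraction of the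
  -- stage and, when `α` is cut off, for the other two.
  have hmain : k ^ 3 * (a * c * b * d * m ^ 2) ≤ L := by
    refine le_trans ?_ h₃
    have : k ^ 3 ≤ k ^ 2 := pow_le_pow_of_le_one hk.le hk1 (by norm_num)
    rw [mul_pow]
    calc k ^ 3 * (a * c * b * d * m ^ 2) ≤ k ^ 2 * (a * c * b * d * m ^ 2) := by gcongr
      _ = _ := by ring
  have hsecond : a * c * b * d * (α * β * m) ≤ 2 * (a * c * b * d * m ^ 2) := by
    calc a * c * b * d * (α * β * m) ≤ a * c * b * d * (2 * m * m) := by gcongr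
      _ = _ := by ring
  have hβ : β ≤ 2 * m / α := by
    rw [le_div_iff₀ hα, mul_comm]
    exact hαβ
  have hthird : a * c * d * (β * m * (2 * m)) ≤ 4 * (a * c * d * m ^ 3 / α) := by
    calc a * c * d * (β * m * (2 * m)) ≤ a * c * d * (2 * m / α * m * (2 * m)) := by gcongr
      _ = _ := by ring
  have hX0 : 0 ≤ a * c * b * d * (m : ℝ) ^ 2 := by positivity
  -- For `ρ ≤ 1` rounding gives `α = 1`, and mc ≤ b makes both outer terms at most abcdm².
  rcases le_total ρ 1 with hρ1 | hρ1
  · have hα1 : α = 1 := by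
      refine le_antisymm ?_ ?_
      · rw [hsplit]
        refine (min_le_right _ _).trans ?_
        exact_mod_cast Nat.ceil_le.mpr (by simpa using hρ1)
      · exact Nat.one_le_cast.mpr (D.splitSize_pos hm A B)
    have hmc : m * c ≤ b := by
      rw [← hρb]
      exact mul_le_of_le_one_left (by positivity) (pow_le_one₀ hρ0 hρ1)
    have e₁ : a * b * d * (m * α * m) ≤ a * c * b * d * m ^ 2 := by
      rw [hα1]
      calc a * b * d * (m * 1 * m) = a * 1 * b * d * m ^ 2 := by ring
        _ ≤ _ := by gcongr
    have e₃ : a * c * d * m ^ 3 / α ≤ a * c * b * d * m ^ 2 := by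
      rw [hα1, div_one]
      calc a * c * d * m ^ 3 = a * 1 * (m * c) * d * m ^ 2 := by ring
        _ ≤ a * c * b * d * m ^ 2 := by gcongr
    have : k ^ 3 * (a * b * d * (m * α * m) + a * c * b * d * (α * β * m) +
        a * c * d * (β * m * (2 * m))) ≤ k ^ 3 * (8 * (a * c * b * d * m ^ 2)) := by
      gcongr
      linarith
    linarith
  -- For `ρ ≥ m` the cutoff gives `α = m`, and mb ≤ c has the same effect.
  · rcases le_total (m : ℝ) ρ with hρm | hρm
    · have hα1 : α = m := by
        rw [hsplit]
        exact min_eq_left (hρm.trans (Nat.le_ceil _))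
      have hmc : m * b ≤ c := by
        have : (m : ℝ) ^ 2 * b ≤ m * c := by
          rw [← hρb]
          gcongr
        have hm0 : (0 : ℝ) < m := by linarith
        refine le_of_mul_le_mul_left ?_ hm0
        linarith
      have e₁ : a * b * d * (m * α * m) ≤ a * c * b * d * m ^ 2 := by
        rw [hα1]
        calc a * b * d * (m * m * m) = a * (m * b) * 1 * d * m ^ 2 := by ring
          _ ≤ _ := by gcongr
      have e₃ : a * c * d * m ^ 3 / α ≤ a * c * b * d * m ^ 2 := by
        rw [hα1]
        calc a * c * d * m ^ 3 / m = a * c * 1 * d * m ^ 2 := by field_simp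
          _ ≤ a * c * b * d * m ^ 2 := by gcongr
      have : k ^ 3 * (a * b * d * (m * α * m) + a * c * b * d * (α * β * m) +
          a * c * d * (β * m * (2 * m))) ≤ k ^ 3 * (8 * (a * c * b * d * m ^ 2)) := by
        gcongr
        linarith
      linarith
    -- In the balanced range ρ ≤ α ≤ 2ρ, both outer terms are comparable to abdm²ρ = d√(a²bcm⁵).
    · have hρpos : 0 < ρ := by linarith
      have hαle : α ≤ 2 * ρ := by
        rw [hsplit]
        exact (min_le_right _ _).trans (le_two_mul_of_le_ceil hρ1)
      have hρα : ρ ≤ α := by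
        rw [hsplit]
        exact le_min hρm (Nat.le_ceil _)
      have e₁ : a * b * d * (m * α * m) ≤ 2 * (a * b * d * m ^ 2 * ρ) := by
        calc a * b * d * (m * α * m) ≤ a * b * d * (m * (2 * ρ) * m) := by gcongr
          _ = _ := by ring
      have e₃ : a * c * d * m ^ 3 / α ≤ a * b * d * m ^ 2 * ρ := by
        calc a * c * d * m ^ 3 / α ≤ a * c * d * m ^ 3 / ρ := by gcongr
          _ = a * d * m ^ 2 * (m * c) / ρ := by ring
          _ = _ := by rw [← hρb]; field_simp
      have hL : 0 ≤ L := le_trans (by positivity) hmain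
      -- Geometric mean of `h₁` and `h₂`: after squaring, `t` and `u` occur only through `t * u`,
      -- which contributes the fifth factor `k * m`. Here `a ≤ p` replaces one factor a by p.
      have hX : k ^ 3 * (a * b * d * m ^ 2 * ρ) ≤ L := by
        refine le_of_sq_le_sq ?_ hL
        have hp : 0 < p := by linarith
        calc (k ^ 3 * (a * b * d * m ^ 2 * ρ)) ^ 2
            = k ^ 6 * (a * a * b * d ^ 2 * m ^ 4 * (ρ ^ 2 * b)) := by ring
          _ = k ^ 6 * (a * a * b * c * d ^ 2 * m ^ 5) := by rw [hρb]; ring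
          _ ≤ k ^ 5 * (p * a * b * c * d ^ 2 * m ^ 5) := by
            have : k ^ 6 ≤ k ^ 5 := pow_le_pow_of_le_one hk.le hk1 (by norm_num)
            gcongr
          _ = p * b * d * (k * m) ^ 2 * (a * c * d * (k * m) ^ 2) * (k * m) := by ring
          _ ≤ p * b * d * (k * m) ^ 2 * (a * c * d * (k * m) ^ 2) * (t * u) := by gcongr
          _ = (p * b * d * ((k * m) ^ 2 * t)) * (a * c * d * ((k * m) ^ 2 * u)) := by ring
          _ ≤ L * L := by gcongr
          _ = L ^ 2 := by ring
      -- The first term contributes 2, the third 4 multiples of abdm²ρ, and the middle one 2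
      -- multiples of abcdm²; this is the 8 in the conclusion.
      have : k ^ 3 * (a * b * d * (m * α * m) + a * c * b * d * (α * β * m) +
          a * c * d * (β * m * (2 * m))) ≤
          k ^ 3 * (2 * (a * c * b * d * m ^ 2) + 6 * (a * b * d * m ^ 2 * ρ)) :=
        mul_le_mul_of_nonneg_left (by linarith) (by positivity)
      linarith

end DataNetwork

/-! ### Lower bound for constrained contraction trees -/

namespace DataNetwork

open ContractionTree

variable {V E S VE EE : Type*} [Fintype EE] (D : DataNetwork V E S) (F : Embedding S VE EE)

/-- The data tensors precede the embedding tensors, and the row of a data tensor consists of its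
edge to be sketched. -/
noncomputable def rowSystem (hD : Function.Surjective D.vertex) (ord : VE → ℕ) {κ : ℝ}
    (hsize : ∀ s, κ ≤ D.size s) (hrow : ∀ v, κ ≤ F.rowSize ord v) (hout : F.outputs.card = 1) :
    (D.withEmbedding F).RowSystem κ where
  -- The shift puts every embedding tensor strictly after the data. Data tensors may share position
  -- 0, since only comparisons of positions are used.
  ord := Sum.elim (fun _ => 0) fun v => ord v + 1
  row := Sum.elim (fun v => {.inr (.inl (Alg.edgeAt D hD v))}) fun v =>
    (Finset.univ.filter fun f => v ∈ F.ends f ∧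
      ((F.ends f).card = 1 ∨ ∃ u ∈ F.ends f, ord v < ord u)).map
      (Function.Embedding.inr.trans Function.Embedding.inr)
  mem_ends := by
    rintro (v | v) e he
    · obtain rfl := Finset.mem_singleton.mp he
      simp [withEmbedding, Alg.edgeAt, Function.surjInv_eq]
    · obtain ⟨f, hf, rfl⟩ := Finset.mem_map.mp he
      simpa [withEmbedding] using (Finset.mem_filter.mp hf).2.1
  exits := by
    rintro (v | v) e he
    · obtain rfl := Finset.mem_singleton.mp he
      exact .inr ⟨.inr (F.input (Alg.edgeAt D hD v)), by simp [withEmbedding], by simp⟩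
    · obtain ⟨f, hf, rfl⟩ := Finset.mem_map.mp he
      refine (Finset.mem_filter.mp hf).2.2.imp id ?_
      rintro ⟨u, hu, hlt⟩
      exact ⟨.inr u, by simpa [withEmbedding] using hu, by simpa using hlt⟩
  disjoint_row := by
    rintro (v | v) (w | w) hvw
    · have : Alg.edgeAt D hD v ≠ Alg.edgeAt D hD w := fun h =>
        hvw (congrArg _ (Function.injective_surjInv hD h))
      simpa using this
    · simp
    · simp
    -- An edge in the rows of both `v` and `w` has exactly these two ends, and each of them would
    -- have to precede the other.
    · rw [Sum.elim_inr, Sum.elim_inr, Finset.disjoint_map, Finset.disjoint_left]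
      intro f hf hf'
      obtain ⟨hv, hv'⟩ := (Finset.mem_filter.mp hf).2
      obtain ⟨hw, hw'⟩ := (Finset.mem_filter.mp hf').2
      have hne : v ≠ w := fun h => hvw (congrArg _ h)
      have hcard : (F.ends f).card ≠ 1 := fun h =>
        hne (Finset.card_le_one.mp h.le v hv w hw)
      have hends : {v, w} = F.ends f := by
        refine Finset.eq_of_subset_of_card_le (by simp [Finset.insert_subset_iff, hv, hw]) ?_
        rw [Finset.card_pair hne]
        exact ((F.ends_card f).resolve_left hcard).le
      rw [← hends] at hv' hw' hcard
      have h₁ := hv'.resolve_left hcard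
      have h₂ := hw'.resolve_left hcard
      simp only [Finset.mem_insert, Finset.mem_singleton, exists_eq_or_imp, exists_eq_left,
        lt_irrefl, false_or, or_false] at h₁ h₂
      omega
  le_prod := by
    rintro (v | v)
    · simpa [withEmbedding] using hsize _
    · refine (hrow v).trans (le_of_eq ?_)
      rw [Sum.elim_inr, Finset.prod_map, Embedding.rowSize, Nat.cast_prod]
      rfl
  dangling_unique := by
    -- Data indices lie in no row and sketched edges do not dangle, so only the single output edge
    -- of the embedding remains.
    rintro x y (e | s | e) he (f | s' | f) hf hed hfd
    · rcases x with x | x <;> simp at he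
    · exact hfd.elim
    · rcases x with x | x <;> simp at he
    · exact hed.elim
    · exact hed.elim
    · exact hed.elim
    · rcases y with y | y <;> simp at hf
    · exact hfd.elim
    · have h₁ : e ∈ F.outputs := Finset.mem_filter.mpr ⟨Finset.mem_univ e, hed⟩
      have h₂ : f ∈ F.outputs := Finset.mem_filter.mpr ⟨Finset.mem_univ f, hfd⟩
      rw [Finset.card_le_one.mp hout.le e h₁ f h₂]

variable {D F}

section

variable {hD : Function.Surjective D.vertex} {ord : VE → ℕ} {κ : ℝ}
  {hsize : ∀ s, κ ≤ D.size s} {hrow : ∀ v, κ ≤ F.rowSize ord v} {hout : F.outputs.card = 1}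

lemma disjoint_dataEdges_row (X : Finset E) (w : V ⊕ VE) :
    Disjoint (dataEdges S EE X) ((D.rowSystem F hD ord hsize hrow hout).row w) := by
  rw [Finset.disjoint_left]
  intro e he hw
  obtain ⟨f, -, rfl⟩ := Finset.mem_map.mp he
  rcases w with w | w <;> simp [rowSystem] at hw

variable [Fintype E] [Fintype S]

/-- The cost of a contraction and its neighbours in a tree, in terms of the part `t` of the row of
the last tensor of `B` that is adjacent to `A`, and the other part `u`. -/
lemma exists_le_cost (hκ : 0 ≤ κ) {A B : Finset (V ⊕ VE)} (hAB : Disjoint A B)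
    {x y : V ⊕ VE} (hx : x ∈ A) (hy : y ∈ B)
    (hxA : ∀ z ∈ A, (D.rowSystem F hD ord hsize hrow hout).ord z ≤
      (D.rowSystem F hD ord hsize hrow hout).ord x)
    (hyB : ∀ z ∈ B, (D.rowSystem F hD ord hsize hrow hout).ord z ≤
      (D.rowSystem F hD ord hsize hrow hout).ord y)
    (hyx : (D.rowSystem F hD ord hsize hrow hout).ord y ≤
      (D.rowSystem F hD ord hsize hrow hout).ord x)
    {U U' : Finset V} (hU : dataPart A = U) (hU' : dataPart B = U') (hUne : U.Nonempty)
    {a L : ℝ} (hmain : (D.withEmbedding F).contractionCost A B ≤ L)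
    (ha : IsFormingCost (D.withEmbedding F) A a) (haL : a ≤ L)
    (hR : (∀ w, w ∈ A ∪ B) ∨ ∃ R : Finset (V ⊕ VE), R.Nonempty ∧ Disjoint (A ∪ B) R ∧
      (D.withEmbedding F).contractionCost (A ∪ B) R ≤ L) :
    ∃ t u : ℝ, 0 ≤ u ∧ κ ≤ t * u ∧
      D.outerSize U U' * D.contractedSize U U' * D.sharedSize U U' * (κ ^ 2 * t) ≤ L ∧
      D.outerSize U U' * D.outerSize U' U * D.sharedSize U U' * (κ ^ 2 * u) ≤ L ∧
      D.outerSize U U' * D.outerSize U' U * D.contractedSize U U' * D.sharedSize U U' * κ ^ 2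
        ≤ L := by
  have hUU' : Disjoint U U' := hU ▸ hU' ▸ disjoint_dataPart hAB
  have hb := D.one_le_contractedSize hUU'
  have hq := D.one_le_outerSize hUU'.symm
  have hp := D.outerSize_pos U U'
  have hd := D.sharedSize_pos U U'
  set R := D.rowSystem F hD ord hsize hrow hout with hRdef
  have hX : ∀ X, ∀ w, Disjoint (dataEdges S EE X) (R.row w) := disjoint_dataEdges_row
  have h₃ : D.outerSize U U' * D.outerSize U' U * D.contractedSize U U' * D.sharedSize U U' *
      κ ^ 2 ≤ L := by
    refine le_trans ?_ hmain
    have := R.le_mainCost hAB hx hy hxA hyB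
      (hX (D.rest.edgesOf U ∪ D.rest.edgesOf U')) hκ (by
        rw [dataEdges, Finset.map_union, ← hU, ← hU']
        exact Finset.union_subset_union (D.dataEdges_subset_edgesOf F)
          (D.dataEdges_subset_edgesOf F))
    rwa [prod_dataEdges, ← D.rest.contractionCost_eq hUU', contractionCost_rest_eq] at this
  have htu := R.le_rowTo_mul_rowAway y A
  have ht1 := (D.withEmbedding F).one_le_prod_dim (R.rowTo y A)
  have hu1 := (D.withEmbedding F).one_le_prod_dim (R.rowAway y A)
  have h₁ : D.outerSize U U' * D.contractedSize U U' * D.sharedSize U U' *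
      (κ ^ 2 * ∏ e ∈ R.rowTo y A, ((D.withEmbedding F).dim e : ℝ)) ≤ L := by
    -- If `A` is a single tensor, nothing forms it. Its data part is nonempty, so it is a data
    -- tensor at position 0, and `y` is then one as well; the sketched edge of `y` does not touch
    -- `A`. Hence t = 1, and the bound follows from `h₃` because q ≥ 1.
    rcases ha with ⟨z, rfl, -⟩ | ⟨A₁, A₂, hA₁, hA₂, hd, hA, rfl⟩
    · have hemp : R.rowTo y {z} = ∅ := by
        obtain rfl := Finset.mem_singleton.mp hx
        obtain ⟨v, hv⟩ := hUne
        rw [← hU, mem_dataPart, Finset.mem_singleton] at hv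
        subst hv
        rcases y with w | w
        · refine Finset.eq_empty_of_forall_notMem fun e he => ?_
          obtain ⟨he, v', hv', hv''⟩ := R.mem_rowTo.mp he
          obtain rfl := Finset.mem_singleton.mp he
          obtain rfl := Finset.mem_singleton.mp hv''
          simp only [withEmbedding, Finset.mem_insert, Sum.inl.injEq, Finset.mem_singleton,
            reduceCtorEq, or_false, Alg.edgeAt, Function.surjInv_eq] at hv'
          subst hv'
          exact Finset.disjoint_left.mp hAB hx hy
        · simp [hRdef, rowSystem] at hyx
      rw [hemp, Finset.prod_empty, mul_one]
      refine le_trans ?_ h₃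
      calc _ = D.outerSize U U' * 1 * D.contractedSize U U' * D.sharedSize U U' * κ ^ 2 := by
            ring
        _ ≤ _ := by gcongr
    · refine le_trans ?_ haL
      have := R.le_formingCost hAB hx hy hxA (hX (D.rest.edgesOf U)) hκ hA₁ hA₂ hd hA
        (by rw [← hU]; exact D.dataEdges_subset_edgesOf F)
      rwa [prod_dataEdges, ← D.rest.exp_cut, D.exp_cut_eq U U'] at this
  -- Without a consuming contraction u = 1 is used; its bound follows from `h₃` since b ≥ 1. The
  -- condition κ ≤ t holds if the whole row of `y` points to `A`, or trivially if κ ≤ 1 ≤ t.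
  have root (hu : R.rowAway y A = ∅ ∨ κ ≤ 1) : ∃ t u : ℝ, 0 ≤ u ∧ κ ≤ t * u ∧
      D.outerSize U U' * D.contractedSize U U' * D.sharedSize U U' * (κ ^ 2 * t) ≤ L ∧
      D.outerSize U U' * D.outerSize U' U * D.sharedSize U U' * (κ ^ 2 * u) ≤ L ∧
      D.outerSize U U' * D.outerSize U' U * D.contractedSize U U' * D.sharedSize U U' * κ ^ 2
        ≤ L := by
    refine ⟨_, 1, zero_le_one, ?_, h₁, le_trans ?_ h₃, h₃⟩
    · rcases hu with hu | hu
      · rwa [hu, Finset.prod_empty] at htu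
      · linarith
    · calc _ = D.outerSize U U' * D.outerSize U' U * 1 * D.sharedSize U U' * κ ^ 2 := by ring
        _ ≤ _ := by gcongr
  rcases hR with huniv | ⟨C, hC, hABC, hCL⟩
  · refine root ((le_or_gt κ 1).symm.imp (fun h => ?_) id)
    exact R.rowAway_eq_empty hAB hx hy hxA hyB hyx huniv h
  · refine ⟨_, _, by linarith, htu, h₁, le_trans ?_ hCL, h₃⟩
    have := R.le_consumingCost hAB hx hy hxA hyB hyx (hX (D.rest.edgesOf (U ∪ U'))) hκ hC hABC
      (by rw [← hU, ← hU', ← dataPart_union]; exact D.dataEdges_subset_edgesOf F)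
    rwa [prod_dataEdges, ← D.rest.exp_cut, exp_cut_union_eq] at this

end

variable [Fintype E] [Fintype S] (hD : Function.Surjective D.vertex) {ord : VE → ℕ} {k : ℝ}
  {m : ℕ} (hm : 0 < m)
  (hk : 0 < k) (hk1 : k ≤ 1) (hsize : ∀ s, m < D.size s) (hrow : ∀ v, k * m ≤ F.rowSize ord v)
  (hout : F.outputs.card = 1) {T : ContractionTree (V ⊕ VE)} (hT : T.IsFull)

include hD hm hk hk1 hsize hrow hout hT

/-- The last tensor of either operand may be the later one, independently of which operand the
algorithm sketches first. Both cases are covered because a ≤ c: the later operand has outer size a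
or c, at least a in either case. -/
lemma stageCost_le_neighborCost (i : T.Contraction) {A B : Finset V}
    (hAB : (dataPart (T.leftVerts i) = A ∧ dataPart (T.rightVerts i) = B) ∨
      (dataPart (T.leftVerts i) = B ∧ dataPart (T.rightVerts i) = A))
    (hA : A.Nonempty) (hB : B.Nonempty) (hac : D.outerSize A B ≤ D.outerSize B A) :
    k ^ 3 * D.stageCost m A B ≤ 8 * neighborCost (D.withEmbedding F) 0 T i := by
  have hκsize : ∀ s, k * m ≤ D.size s := fun s => by
    have : (m : ℝ) < D.size s := Nat.cast_lt.mpr (hsize s)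
    nlinarith [(Nat.cast_nonneg m : (0 : ℝ) ≤ m)]
  have hκ : 0 ≤ k * m := by positivity
  obtain ⟨a, b, c, habc, ha, hb, hc⟩ := neighborCost_spec (D.withEmbedding F) T hT.1 0 i
  have hd := T.disjoint_leftVerts_rightVerts hT.1 i
  have hdAB : Disjoint A B := by
    have := disjoint_dataPart hd
    rcases hAB with ⟨rfl, rfl⟩ | ⟨rfl, rfl⟩
    · exact this
    · exact this.symm
  have ha0 := isFormingCost_nonneg ha
  have hb0 := isFormingCost_nonneg hb
  have hmain := (D.withEmbedding F).contractionCost_pos (T.leftVerts i) (T.rightVerts i)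
  have hc0 : 0 ≤ c := by
    rcases hc with ⟨-, rfl⟩ | ⟨_, -, -, rfl⟩
    · exact le_rfl
    · exact ((D.withEmbedding F).contractionCost_pos _ _).le
  have hC : (∀ w, w ∈ T.leftVerts i ∪ T.rightVerts i) ∨ ∃ R : Finset (V ⊕ VE), R.Nonempty ∧
      Disjoint (T.leftVerts i ∪ T.rightVerts i) R ∧
      (D.withEmbedding F).contractionCost (T.leftVerts i ∪ T.rightVerts i) R ≤
        neighborCost (D.withEmbedding F) 0 T i := by
    refine hc.imp (fun h w => ?_) fun ⟨R, h₁, h₂, h₃⟩ => ⟨R, h₁, h₂, by linarith⟩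
    rw [h.1, mem_verts]
    exact hT.2 w
  have finish (U U' : Finset V) (hUU' : (U = A ∧ U' = B) ∨ (U = B ∧ U' = A))
      (h : ∃ t u : ℝ, 0 ≤ u ∧ k * m ≤ t * u ∧
        D.outerSize U U' * D.contractedSize U U' * D.sharedSize U U' * ((k * m) ^ 2 * t) ≤
          neighborCost (D.withEmbedding F) 0 T i ∧
        D.outerSize U U' * D.outerSize U' U * D.sharedSize U U' * ((k * m) ^ 2 * u) ≤
          neighborCost (D.withEmbedding F) 0 T i ∧
        D.outerSize U U' * D.outerSize U' U * D.contractedSize U U' * D.sharedSize U U' *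
          (k * m) ^ 2 ≤ neighborCost (D.withEmbedding F) 0 T i) :
      k ^ 3 * D.stageCost m A B ≤ 8 * neighborCost (D.withEmbedding F) 0 T i := by
    obtain ⟨t, u, hu, htu, h₁, h₂, h₃⟩ := h
    rcases hUU' with ⟨rfl, rfl⟩ | ⟨rfl, rfl⟩
    · exact D.stageCost_le hm hdAB hk hk1 le_rfl rfl hu htu h₁ h₂ h₃
    · rw [D.contractedSize_comm, D.sharedSize_comm] at h₁ h₃
      rw [D.sharedSize_comm] at h₂
      exact D.stageCost_le hm hdAB hk hk1 hac (mul_comm _ _) hu htu h₁ h₂ h₃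
  have hUne : (dataPart (T.leftVerts i)).Nonempty ∧ (dataPart (T.rightVerts i)).Nonempty := by
    rcases hAB with ⟨h, h'⟩ | ⟨h, h'⟩ <;> rw [h, h'] <;> exact ⟨‹_›, ‹_›⟩
  let R := D.rowSystem F hD ord hκsize hrow hout
  obtain ⟨x, hx, hxmax⟩ := R.exists_last (T.leftVerts_nonempty i)
  obtain ⟨y, hy, hymax⟩ := R.exists_last (T.rightVerts_nonempty i)
  rcases le_total (R.ord y) (R.ord x) with hyx | hxy
  · refine finish _ _ hAB (exists_le_cost hκ hd hx hy hxmax hymax hyx rfl rfl hUne.1 ?_ ha ?_ hC)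
    all_goals linarith
  · refine finish _ _ (hAB.symm.imp And.symm And.symm) (exists_le_cost hκ hd.symm hy hx hymax
      hxmax hxy rfl rfl hUne.2 ?_ hb ?_ ?_)
    · rw [TensorNetwork.contractionCost_comm]
      linarith
    · linarith
    · rwa [Finset.union_comm]

/-- The lower bound for the contractions of the data with the sketches. -/
lemma sum_stageCost_le {T₀ : ContractionTree V} (hT₀ : T₀.IsFull) (hcon : T.ConstrainedOn T₀) :
    k ^ 3 * ∑ i, D.stageCost m (Alg.firstVerts D T₀ i) (Alg.secondVerts D T₀ i) ≤
      32 * T.cost (D.withEmbedding F) := by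
  have hex : ∀ i : T₀.Contraction, ∃ n : T.Contraction,
      (dataPart (T.leftVerts n) = T₀.leftVerts i ∧
        dataPart (T.rightVerts n) = T₀.rightVerts i) ∨
      (dataPart (T.leftVerts n) = T₀.rightVerts i ∧
        dataPart (T.rightVerts n) = T₀.leftVerts i) := by
    intro i
    obtain ⟨q, hq, h⟩ := hcon _ (mem_contractions_iff.mpr ⟨i, rfl⟩)
    obtain ⟨n, rfl⟩ := mem_contractions_iff.mp hq
    exact ⟨n, h⟩
  choose n hn using hex
  -- The data part of the result of `n i` is the vertex set contracted by `i`, which determines `i`.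
  have hinj : Function.Injective n := by
    intro i j hij
    refine T₀.leftVerts_union_rightVerts_injective hT₀.1 ?_
    have key : ∀ i, T₀.leftVerts i ∪ T₀.rightVerts i =
        dataPart (T.leftVerts (n i)) ∪ dataPart (T.rightVerts (n i)) := by
      intro i
      rcases hn i with ⟨h, h'⟩ | ⟨h, h'⟩
      · rw [h, h']
      · rw [h, h', Finset.union_comm]
    exact (key i).trans ((congrArg (fun n => dataPart (T.leftVerts n) ∪
      dataPart (T.rightVerts n)) hij).trans (key j).symm)
  have hstage : ∀ i, k ^ 3 * D.stageCost m (Alg.firstVerts D T₀ i) (Alg.secondVerts D T₀ i) ≤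
      8 * neighborCost (D.withEmbedding F) 0 T (n i) := by
    intro i
    by_cases h : Alg.LeftFirst D (T₀.leftVerts i) (T₀.rightVerts i)
    · rw [Alg.firstVerts, Alg.secondVerts, if_pos h, if_pos h]
      exact stageCost_le_neighborCost hD hm hk hk1 hsize hrow hout hT (n i) (hn i)
        (T₀.leftVerts_nonempty i) (T₀.rightVerts_nonempty i) h
    · rw [Alg.firstVerts, Alg.secondVerts, if_neg h, if_neg h]
      exact stageCost_le_neighborCost hD hm hk hk1 hsize hrow hout hT (n i) (hn i).symm
        (T₀.rightVerts_nonempty i) (T₀.leftVerts_nonempty i) (le_of_not_ge h)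
  calc _ = ∑ i, k ^ 3 * D.stageCost m (Alg.firstVerts D T₀ i) (Alg.secondVerts D T₀ i) :=
        Finset.mul_sum _ _ _
    _ ≤ ∑ i, 8 * neighborCost (D.withEmbedding F) 0 T (n i) :=
        Finset.sum_le_sum fun i _ => hstage i
    _ = 8 * ∑ i, neighborCost (D.withEmbedding F) 0 T (n i) := (Finset.mul_sum _ _ _).symm
    _ ≤ 8 * ∑ j, neighborCost (D.withEmbedding F) 0 T j := by
        gcongr
        have h := Finset.sum_map Finset.univ ⟨n, hinj⟩ (neighborCost (D.withEmbedding F) 0 T)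
        exact h.symm.trans_le (Finset.sum_le_sum_of_subset_of_nonneg (Finset.subset_univ _)
          fun j _ _ => neighborCost_nonneg _ _ le_rfl _ _)
    _ ≤ 8 * (4 * T.cost (D.withEmbedding F)) := by
        have h₁ := sum_neighborCost_le (D.withEmbedding F) T 0 le_rfl
        have h₂ := T.topCost_nonneg (D.withEmbedding F)
        linarith
    _ = _ := by ring

/-- The lower bound for the first contractions of the data tensors. -/
lemma sum_leafCost_le [Nonempty V] {l : List V} (hl : l.Nodup) :
    k * (l.map fun v => Real.exp (D.rest.cut {v}) * D.size (Alg.edgeAt D hD v) * m).sum ≤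
      2 * T.cost (D.withEmbedding F) := by
  have hκsize : ∀ s, k * m ≤ D.size s := fun s => by
    have : (m : ℝ) < D.size s := Nat.cast_lt.mpr (hsize s)
    nlinarith [(Nat.cast_nonneg m : (0 : ℝ) ≤ m)]
  have hκ : 0 ≤ k * m := by positivity
  let R := D.rowSystem F hD ord hκsize hrow hout
  -- Only data tensors carry weight; embedding tensors cost nothing here.
  let g : V ⊕ VE → ℝ := Sum.elim (fun v => k * (Real.exp (D.rest.cut {v}) *
    D.size (Alg.edgeAt D hD v) * m)) fun _ => 0
  have hg : ∀ x (B : Finset (V ⊕ VE)), B.Nonempty → Disjoint {x} B →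
      g x ≤ (D.withEmbedding F).contractionCost {x} B := by
    rintro (v | v) B hB hd
    · obtain ⟨z, hz, hzmax⟩ := R.exists_last hB
      have hXrow : ∀ w, Disjoint (dataEdges S EE (D.rest.edgesOf {v})) (R.row w) :=
        disjoint_dataEdges_row _
      have hdp : dataPart ({.inl v} : Finset (V ⊕ VE)) = {v} := by
        ext w
        simp [mem_dataPart]
      have hsub := D.dataEdges_subset_edgesOf F (A := {.inl v})
      rw [hdp] at hsub
      -- The first contraction of a data tensor sees its data indices, its whole sketched edge
      -- (which is its row), and the row of the last tensor of the other operand.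
      have := (D.withEmbedding F).prod_le_contractionCost hd
        (s := dataEdges S EE (D.rest.edgesOf {v}) ∪ (R.row (.inl v) ∪ R.row z))
        (Finset.union_subset (hsub.trans Finset.subset_union_left)
          (Finset.union_subset_union (R.row_subset_edgesOf (Finset.mem_singleton_self _)
            (by simp)) (R.row_subset_edgesOf hz hzmax)))
      rw [Finset.prod_union, Finset.prod_union, prod_dataEdges, ← D.rest.exp_cut] at this
      · refine le_trans ?_ this
        have h₁ : ∏ e ∈ R.row (.inl v), ((D.withEmbedding F).dim e : ℝ) =
            D.size (Alg.edgeAt D hD v) := Finset.prod_singleton _ _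
        have h₂ := R.le_prod z
        rw [h₁]
        calc g (.inl v) = Real.exp (D.rest.cut {v}) *
              (D.size (Alg.edgeAt D hD v) * (k * m)) := by simp only [g, Sum.elim_inl]; ring
          _ ≤ _ := by gcongr
      · refine R.disjoint_row _ _ ?_
        rintro rfl
        exact Finset.disjoint_left.mp hd (Finset.mem_singleton_self _) hz
      · exact Finset.disjoint_union_right.mpr ⟨hXrow _, hXrow _⟩
    · exact ((D.withEmbedding F).contractionCost_pos _ _).le
  have hg0 : ∀ x, 0 ≤ g x := by
    rintro (v | v)
    · simp only [g, Sum.elim_inl]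
      positivity
    · exact le_rfl
  have hT' : (T.leaves.map g).sum ≤ 2 * T.cost (D.withEmbedding F) := by
    -- A tree with one leaf is impossible: there is a data tensor and an embedding tensor at its
    -- sketched edge.
    rcases T with x | ⟨L, R⟩
    · obtain ⟨v⟩ := ‹Nonempty V›
      have h₁ := hT.2 (.inl v)
      have h₂ := hT.2 (.inr (F.input (Alg.edgeAt D hD v)))
      rw [leaves, List.mem_singleton] at h₁ h₂
      exact (Sum.inl_ne_inr (h₁.trans h₂.symm)).elim
    · exact sum_leaves_le _ g hg L R hT.1
  refine le_trans ?_ hT'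
  rw [← List.sum_map_mul_left]
  have : (l.map fun v => k * (Real.exp (D.rest.cut {v}) * D.size (Alg.edgeAt D hD v) * m)) =
      (l.map Sum.inl).map g := by
    rw [List.map_map]
    rfl
  rw [this, ← List.sum_toFinset _ hT.1, ← List.sum_toFinset _ (hl.map Sum.inl_injective)]
  refine Finset.sum_le_sum_of_subset_of_nonneg (fun x _ => ?_) fun x _ _ => hg0 x
  exact List.mem_toFinset.mpr (hT.2 x)

end DataNetwork

/-! ### Parents and children in the data contraction tree -/

namespace ContractionTree

variable {V : Type*}

/-- The left (`false`) or right (`true`) child of a contraction. -/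
def child (t : ContractionTree V) (p : t.Contraction × Bool) : V ⊕ t.Contraction :=
  if p.2 then t.rightChild p.1 else t.leftChild p.1

/-- `x` is a vertex of the tree: a contraction, or the label of a leaf. -/
def IsNode (t : ContractionTree V) : V ⊕ t.Contraction → Prop
  | .inl v => v ∈ t.leaves
  | .inr _ => True

lemma isNode_root : ∀ t : ContractionTree V, t.IsNode t.root
  | leaf v => List.mem_singleton_self v
  | node _ _ => trivial

lemma IsNode.ofLeft {l r : ContractionTree V} : ∀ {x}, l.IsNode x →
    (node l r).IsNode (ofLeft x)
  | .inl _, h => List.mem_append_left _ h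
  | .inr _, _ => trivial

lemma IsNode.ofRight {l r : ContractionTree V} : ∀ {x}, r.IsNode x →
    (node l r).IsNode (ofRight x)
  | .inl _, h => List.mem_append_right _ h
  | .inr _, _ => trivial

lemma isNode_node {l r : ContractionTree V} : ∀ {x}, (node l r).IsNode x →
    x = .inr none ∨ (∃ y, l.IsNode y ∧ x = ofLeft y) ∨ ∃ y, r.IsNode y ∧ x = ofRight y
  | .inl v, h => (List.mem_append.mp h).elim (fun h => .inr (.inl ⟨.inl v, h, rfl⟩))
      fun h => .inr (.inr ⟨.inl v, h, rfl⟩)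
  | .inr none, _ => .inl rfl
  | .inr (some (.inl i)), _ => .inr (.inl ⟨.inr i, trivial, rfl⟩)
  | .inr (some (.inr i)), _ => .inr (.inr ⟨.inr i, trivial, rfl⟩)

lemma child_none {l r : ContractionTree V} (b : Bool) :
    (node l r).child (none, b) = if b then ofRight r.root else ofLeft l.root := rfl

lemma child_inl {l r : ContractionTree V} (i : l.Contraction) (b : Bool) :
    (node l r).child (some (.inl i), b) = ofLeft (l.child (i, b)) := by
  cases b <;> rfl

lemma child_inr {l r : ContractionTree V} (i : r.Contraction) (b : Bool) :
    (node l r).child (some (.inr i), b) = ofRight (r.child (i, b)) := by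
  cases b <;> rfl

lemma isNode_child : ∀ (t : ContractionTree V) (p : t.Contraction × Bool), t.IsNode (t.child p)
  | leaf _, p => Empty.elim p.1
  | node l _, (none, false) => l.isNode_root.ofLeft
  | node _ r, (none, true) => r.isNode_root.ofRight
  | node l r, (some (.inl i), b) => by
      rw [child_inl]
      exact (l.isNode_child (i, b)).ofLeft
  | node l r, (some (.inr i), b) => by
      rw [child_inr]
      exact (r.isNode_child (i, b)).ofRight

lemma root_or_child : ∀ (t : ContractionTree V) (x : V ⊕ t.Contraction), t.IsNode x →
    x = t.root ∨ ∃ p, x = t.child p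
  | leaf _, .inl _, h => .inl (congrArg Sum.inl (List.mem_singleton.mp h))
  | leaf _, .inr i, _ => Empty.elim i
  | node l r, x, h => by
      rcases isNode_node h with rfl | ⟨y, hy, rfl⟩ | ⟨y, hy, rfl⟩
      · exact .inl rfl
      · rcases l.root_or_child y hy with rfl | ⟨⟨i, b⟩, rfl⟩
        · exact .inr ⟨(none, false), rfl⟩
        · exact .inr ⟨(some (.inl i), b), (child_inl i b).symm⟩
      · rcases r.root_or_child y hy with rfl | ⟨⟨i, b⟩, rfl⟩
        · exact .inr ⟨(none, true), rfl⟩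
        · exact .inr ⟨(some (.inr i), b), (child_inr i b).symm⟩

lemma ofLeft_injective {l r : ContractionTree V} :
    Function.Injective (ofLeft : V ⊕ l.Contraction → V ⊕ (node l r).Contraction) :=
  Function.Injective.sumMap Function.injective_id
    ((Option.some_injective _).comp Sum.inl_injective)

lemma ofRight_injective {l r : ContractionTree V} :
    Function.Injective (ofRight : V ⊕ r.Contraction → V ⊕ (node l r).Contraction) :=
  Function.Injective.sumMap Function.injective_id
    ((Option.some_injective _).comp Sum.inr_injective)

lemma ofLeft_ne_ofRight {l r : ContractionTree V} (h : Disjoint l.verts r.verts) :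
    ∀ {x y}, l.IsNode x → r.IsNode y → (ofLeft x : V ⊕ (node l r).Contraction) ≠ ofRight y
  | .inl v, .inl w, hx, hy => fun hxy => by
      obtain rfl : v = w := Sum.inl_injective hxy
      exact Finset.disjoint_left.mp h (mem_verts.mpr hx) (mem_verts.mpr hy)
  | .inl _, .inr _, _, _ => Sum.inl_ne_inr
  | .inr _, .inl _, _, _ => Sum.inr_ne_inl
  | .inr _, .inr _, _, _ => fun hxy =>
      Sum.inl_ne_inr (Option.some_injective _ (Sum.inr_injective hxy))

lemma child_ne_root : ∀ (t : ContractionTree V) (p : t.Contraction × Bool), t.child p ≠ t.root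
  | leaf _, p => Empty.elim p.1
  | node _ _, (none, false) => ofLeft_ne_none _
  | node _ _, (none, true) => ofRight_ne_none _
  | node _ _, (some (.inl i), b) => by
      rw [child_inl]
      exact ofLeft_ne_none _
  | node _ _, (some (.inr i), b) => by
      rw [child_inr]
      exact ofRight_ne_none _

/-- Every vertex has at most one parent and occupies one side of it. Distinct leaf labels are needed
because a leaf is identified with its label. -/
lemma child_injective : ∀ (t : ContractionTree V), t.leaves.Nodup → Function.Injective t.child
  | leaf _, _ => fun p => Empty.elim p.1
  | node l r, h => by
      obtain ⟨hl, hr, hd⟩ := nodup_node h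
      have hL := l.child_injective hl
      have hR := r.child_injective hr
      have hne {x y} (hx : l.IsNode x) (hy : r.IsNode y) :
        (ofLeft x : V ⊕ (node l r).Contraction) ≠ ofRight y := ofLeft_ne_ofRight hd hx hy
      rintro ⟨_ | i | i, b⟩ ⟨_ | j | j, b'⟩ hij
      · rw [child_none, child_none] at hij
        rcases b with _ | _ <;> rcases b' with _ | _
        · rfl
        · exact (hne l.isNode_root r.isNode_root hij).elim
        · exact (hne l.isNode_root r.isNode_root hij.symm).elim
        · rfl
      · rw [child_none, child_inl] at hij
        rcases b with _ | _
        · exact (l.child_ne_root _ (ofLeft_injective hij).symm).elim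
        · exact (hne (l.isNode_child _) r.isNode_root hij.symm).elim
      · rw [child_none, child_inr] at hij
        rcases b with _ | _
        · exact (hne l.isNode_root (r.isNode_child _) hij).elim
        · exact (r.child_ne_root _ (ofRight_injective hij).symm).elim
      · rw [child_none, child_inl] at hij
        rcases b' with _ | _
        · exact (l.child_ne_root _ (ofLeft_injective hij)).elim
        · exact (hne (l.isNode_child _) r.isNode_root hij).elim
      · rw [child_inl, child_inl] at hij
        obtain ⟨rfl, rfl⟩ := Prod.mk.inj (hL (ofLeft_injective hij))
        rfl
      · rw [child_inl, child_inr] at hij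
        exact (hne (l.isNode_child _) (r.isNode_child _) hij).elim
      · rw [child_none, child_inr] at hij
        rcases b' with _ | _
        · exact (hne l.isNode_root (r.isNode_child _) hij.symm).elim
        · exact (r.child_ne_root _ (ofRight_injective hij)).elim
      · rw [child_inl, child_inr] at hij
        exact (hne (l.isNode_child _) (r.isNode_child _) hij.symm).elim
      · rw [child_inr, child_inr] at hij
        obtain ⟨rfl, rfl⟩ := Prod.mk.inj (hR (ofRight_injective hij))
        rfl

/-- The data vertices below a vertex of the tree. -/
noncomputable def nodeVerts (t : ContractionTree V) : V ⊕ t.Contraction → Finset V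
  | .inl v => {v}
  | .inr i => t.leftVerts i ∪ t.rightVerts i

lemma nodeVerts_root : ∀ t : ContractionTree V, t.nodeVerts t.root = t.verts
  | leaf v => (verts_leaf v).symm
  | node l r => (verts_node l r).symm

lemma nodeVerts_ofLeft {l r : ContractionTree V} : ∀ x,
    (node l r).nodeVerts (ofLeft x) = l.nodeVerts x
  | .inl _ => rfl
  | .inr _ => rfl

lemma nodeVerts_ofRight {l r : ContractionTree V} : ∀ x,
    (node l r).nodeVerts (ofRight x) = r.nodeVerts x
  | .inl _ => rfl
  | .inr _ => rfl

lemma nodeVerts_leftChild : ∀ (t : ContractionTree V) (i : t.Contraction),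
    t.nodeVerts (t.leftChild i) = t.leftVerts i
  | leaf _, i => Empty.elim i
  | node l _, none => (nodeVerts_ofLeft _).trans l.nodeVerts_root
  | node l _, some (.inl i) => (nodeVerts_ofLeft _).trans (l.nodeVerts_leftChild i)
  | node _ r, some (.inr i) => (nodeVerts_ofRight _).trans (r.nodeVerts_leftChild i)

lemma nodeVerts_rightChild : ∀ (t : ContractionTree V) (i : t.Contraction),
    t.nodeVerts (t.rightChild i) = t.rightVerts i
  | leaf _, i => Empty.elim i
  | node _ r, none => (nodeVerts_ofRight _).trans r.nodeVerts_root
  | node l _, some (.inl i) => (nodeVerts_ofLeft _).trans (l.nodeVerts_rightChild i)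
  | node _ r, some (.inr i) => (nodeVerts_ofRight _).trans (r.nodeVerts_rightChild i)

/-- This strict growth lets the number of data vertices serve as a linearization of the algorithm's
small networks, from children to parents. -/
lemma card_nodeVerts_child_lt (t : ContractionTree V) (ht : t.leaves.Nodup)
    (p : t.Contraction × Bool) :
    (t.nodeVerts (t.child p)).card < (t.nodeVerts (.inr p.1)).card := by
  obtain ⟨i, b⟩ := p
  have hd := t.disjoint_leftVerts_rightVerts ht i
  have h₁ := (t.leftVerts_nonempty i).card_pos
  have h₂ := (t.rightVerts_nonempty i).card_pos
  have h₃ : (t.nodeVerts (.inr i)).card = (t.leftVerts i).card + (t.rightVerts i).card :=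
    Finset.card_union_of_disjoint hd
  change _ < (t.nodeVerts (.inr i)).card
  cases b
  · have h : t.nodeVerts (t.child (i, false)) = t.leftVerts i := t.nodeVerts_leftChild i
    rw [h]
    omega
  · have h : t.nodeVerts (t.child (i, true)) = t.rightVerts i := t.nodeVerts_rightChild i
    rw [h]
    omega

/-- `f` includes the contractions of the subtree `t` into those of `T`. -/
structure IsSubtree (T t : ContractionTree V) (f : t.Contraction → T.Contraction) : Prop where
  injective : Function.Injective f
  child : ∀ i b, T.child (f i, b) = Sum.map id f (t.child (i, b))
  leftVerts : ∀ i, T.leftVerts (f i) = t.leftVerts i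
  rightVerts : ∀ i, T.rightVerts (f i) = t.rightVerts i

lemma IsSubtree.refl (T : ContractionTree V) : IsSubtree T T id where
  injective := Function.injective_id
  child _ _ := by simp
  leftVerts _ := rfl
  rightVerts _ := rfl

lemma IsSubtree.left {T l r : ContractionTree V} {f : (node l r).Contraction → T.Contraction}
    (h : IsSubtree T (node l r) f) : IsSubtree T l fun i => f (some (.inl i)) where
  injective := h.injective.comp ((Option.some_injective _).comp Sum.inl_injective)
  child i b := by
    refine (h.child (some (.inl i)) b).trans ((congrArg _ (child_inl i b)).trans ?_)
    exact Sum.map_map _ _ _ _ _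
  leftVerts i := h.leftVerts _
  rightVerts i := h.rightVerts _

lemma IsSubtree.right {T l r : ContractionTree V} {f : (node l r).Contraction → T.Contraction}
    (h : IsSubtree T (node l r) f) : IsSubtree T r fun i => f (some (.inr i)) where
  injective := h.injective.comp ((Option.some_injective _).comp Sum.inr_injective)
  child i b := by
    refine (h.child (some (.inr i)) b).trans ((congrArg _ (child_inr i b)).trans ?_)
    exact Sum.map_map _ _ _ _ _
  leftVerts i := h.leftVerts _
  rightVerts i := h.rightVerts _

/-- A vertex of a subtree that has no parent in the subtree is its root. -/
lemma IsSubtree.eq_root {T t : ContractionTree V} {f : t.Contraction → T.Contraction}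
    (h : IsSubtree T t f) (hT : T.leaves.Nodup) {y : V ⊕ t.Contraction} (hy : t.IsNode y)
    (hx : Sum.map id f y = T.root ∨
      ∃ p : T.Contraction × Bool, p.1 ∉ Set.range f ∧ Sum.map id f y = T.child p) :
    y = t.root := by
  refine (t.root_or_child y hy).resolve_right ?_
  rintro ⟨⟨i, b⟩, rfl⟩
  rw [← h.child] at hx
  rcases hx with hx | ⟨p, hp, hx⟩
  · exact T.child_ne_root _ hx
  · exact hp ⟨i, congrArg Prod.fst (T.child_injective hT hx)⟩

end ContractionTree

/-! ### Edges of the algorithm's embedding -/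

namespace Alg

open ContractionTree

variable {V E S : Type*} (D : DataNetwork V E S) (hD : Function.Surjective D.vertex)

lemma edgeAt_injective : Function.Injective (edgeAt D hD) := Function.injective_surjInv hD

lemma vertex_edgeAt (v : V) : D.vertex (edgeAt D hD v) = v := Function.surjInv_eq hD v

lemma edgeAt_vertex (s : S) : edgeAt D hD (D.vertex s) = s :=
  D.vertex_injective (vertex_edgeAt D hD _)

lemma outTensor_injective {X : Type*} :
    Function.Injective (outTensor D hD : V ⊕ X → Vertex S X) := by
  rintro (v | i) (w | j) h
  · exact congrArg _ (edgeAt_injective D hD (Sum.inl_injective h))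
  · exact (Sum.inl_ne_inr h).elim
  · exact (Sum.inr_ne_inl h).elim
  · exact congrArg _ (congrArg Prod.fst (Sum.inr_injective h))

lemma outTensor_ne_first {X : Type*} (x : V ⊕ X) (i : X) :
    outTensor D hD x ≠ .inr (i, 0) := by
  rcases x with v | j <;> simp [outTensor]

variable [Fintype E] (T : ContractionTree V)

/-- Whether the operand that is sketched first is the right one. -/
noncomputable def rightFirst (i : T.Contraction) : Bool :=
  decide ¬ LeftFirst D (T.leftVerts i) (T.rightVerts i)

lemma firstChild_eq (i : T.Contraction) : firstChild D T i = T.child (i, rightFirst D T i) := by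
  by_cases h : LeftFirst D (T.leftVerts i) (T.rightVerts i) <;>
    simp [firstChild, rightFirst, child, h]

lemma secondChild_eq (i : T.Contraction) :
    secondChild D T i = T.child (i, !rightFirst D T i) := by
  by_cases h : LeftFirst D (T.leftVerts i) (T.rightVerts i) <;>
    simp [secondChild, rightFirst, child, h]

/-- The edges that carry the sketch dimension of a vertex of the tree. -/
noncomputable def outEdges (x : V ⊕ T.Contraction) : Finset (Edge T.Contraction) :=
  Finset.univ.filter fun e => (e = none ∧ x = T.root) ∨
    (∃ i, e = some (i, 0) ∧ x = firstChild D T i) ∨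
    ∃ i, (e = some (i, 1) ∨ e = some (i, 2)) ∧ x = secondChild D T i

lemma mem_outEdges {x : V ⊕ T.Contraction} {e : Edge T.Contraction} : e ∈ outEdges D T x ↔
    (e = none ∧ x = T.root) ∨ (∃ i, e = some (i, 0) ∧ x = firstChild D T i) ∨
      ∃ i, (e = some (i, 1) ∨ e = some (i, 2)) ∧ x = secondChild D T i := by
  simp [outEdges]

variable {T}

lemma outEdges_root : outEdges D T T.root = {none} := by
  ext e
  rw [mem_outEdges, Finset.mem_singleton]
  constructor
  · rintro (⟨h, -⟩ | ⟨i, -, h⟩ | ⟨i, -, h⟩)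
    · exact h
    · exact (T.child_ne_root _ ((firstChild_eq D T i).symm.trans h.symm)).elim
    · exact (T.child_ne_root _ ((secondChild_eq D T i).symm.trans h.symm)).elim
  · rintro rfl
    exact .inl ⟨rfl, rfl⟩

lemma outEdges_firstChild (hT : T.leaves.Nodup) (i : T.Contraction) :
    outEdges D T (firstChild D T i) = {some (i, 0)} := by
  ext e
  rw [mem_outEdges, Finset.mem_singleton]
  constructor
  · rintro (⟨-, h⟩ | ⟨j, rfl, h⟩ | ⟨j, -, h⟩)
    · exact (T.child_ne_root _ ((firstChild_eq D T i).symm.trans h)).elim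
    · rw [firstChild_eq, firstChild_eq] at h
      obtain ⟨rfl, -⟩ := Prod.mk.inj (T.child_injective hT h)
      rfl
    · rw [firstChild_eq, secondChild_eq] at h
      obtain ⟨rfl, h⟩ := Prod.mk.inj (T.child_injective hT h)
      simp at h
  · rintro rfl
    exact .inr (.inl ⟨i, rfl, rfl⟩)

lemma outEdges_secondChild (hT : T.leaves.Nodup) (i : T.Contraction) :
    outEdges D T (secondChild D T i) = {some (i, 1), some (i, 2)} := by
  ext e
  rw [mem_outEdges, Finset.mem_insert, Finset.mem_singleton]
  constructor
  · rintro (⟨-, h⟩ | ⟨j, -, h⟩ | ⟨j, he, h⟩)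
    · exact (T.child_ne_root _ ((secondChild_eq D T i).symm.trans h)).elim
    · rw [firstChild_eq, secondChild_eq] at h
      obtain ⟨rfl, h⟩ := Prod.mk.inj (T.child_injective hT h)
      simp at h
    · rw [secondChild_eq, secondChild_eq] at h
      obtain ⟨rfl, -⟩ := Prod.mk.inj (T.child_injective hT h)
      exact he
  · exact fun h => .inr (.inr ⟨i, h, rfl⟩)

variable {m : ℕ} (hm : 0 < m)

/-- The sketch of a first operand, or of the root, is a single edge of size m; that of a second
operand is split into α and ⌈m/α⌉. The lower bound serves the row sizes, the upper bound the costs.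
-/
lemma prod_outEdges (hT : T.leaves.Nodup) {x : V ⊕ T.Contraction} (hx : T.IsNode x) :
    m ≤ ∏ e ∈ outEdges D T x, (embedding D hD T m hm).dim e ∧
      (∏ e ∈ outEdges D T x, ((embedding D hD T m hm).dim e : ℝ)) ≤ 2 * m := by
  have hm' : (m : ℝ) ≤ 2 * m := by
    have : (0 : ℝ) ≤ m := Nat.cast_nonneg m
    linarith
  rcases T.root_or_child x hx with rfl | ⟨⟨i, b⟩, rfl⟩
  · rw [outEdges_root, Finset.prod_singleton, Finset.prod_singleton]
    exact ⟨le_rfl, hm'⟩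
  · by_cases hb : b = rightFirst D T i
    · rw [hb, ← firstChild_eq, outEdges_firstChild D hT, Finset.prod_singleton,
        Finset.prod_singleton]
      exact ⟨le_rfl, hm'⟩
    · have hb' : b = !rightFirst D T i := by
        revert hb
        cases b <;> cases rightFirst D T i <;> simp
      have hne : (some (i, 1) : Edge T.Contraction) ≠ some (i, 2) := by simp
      rw [hb', ← secondChild_eq, outEdges_secondChild D hT, Finset.prod_pair hne,
        Finset.prod_pair hne]
      exact ⟨D.le_splitSize_mul_cosplitSize hm _ _, D.splitSize_mul_cosplitSize_le hm _ _⟩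

lemma mem_ends_none {u : Vertex S T.Contraction} : u ∈ (embedding D hD T m hm).ends none ↔
    u = outTensor D hD T.root := Finset.mem_singleton

lemma mem_ends_zero {u : Vertex S T.Contraction} {i : T.Contraction} :
    u ∈ (embedding D hD T m hm).ends (some (i, 0)) ↔
      u = outTensor D hD (firstChild D T i) ∨ u = .inr (i, 0) := by
  simp [embedding]

lemma mem_ends_one {u : Vertex S T.Contraction} {i : T.Contraction} :
    u ∈ (embedding D hD T m hm).ends (some (i, 1)) ↔
      u = outTensor D hD (secondChild D T i) ∨ u = .inr (i, 0) := by
  simp [embedding]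

lemma mem_ends_two {u : Vertex S T.Contraction} {i : T.Contraction} :
    u ∈ (embedding D hD T m hm).ends (some (i, 2)) ↔
      u = outTensor D hD (secondChild D T i) ∨ u = .inr (i, 1) := by
  simp [embedding]

lemma mem_ends_three {u : Vertex S T.Contraction} {i : T.Contraction} :
    u ∈ (embedding D hD T m hm).ends (some (i, 3)) ↔ u = .inr (i, 0) ∨ u = .inr (i, 1) := by
  simp [embedding]

lemma card_ends_some : ∀ p : T.Contraction × Fin 4,
    ((embedding D hD T m hm).ends (some p)).card = 2
  | (i, 0) => Finset.card_pair (by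
      rcases firstChild D T i with v | j <;> simp [outTensor])
  | (i, 1) => Finset.card_pair (by
      rcases secondChild D T i with v | j <;> simp [outTensor])
  | (i, 2) => Finset.card_pair (outTensor_secondChild_ne D hD T i)
  | (i, 3) => Finset.card_pair (by simp)

end Alg

/-! ### Index sets of the combined network -/

namespace DataNetwork

variable {V E S VE EE : Type*} [Fintype E] [Fintype S] [Fintype EE]
  (D : DataNetwork V E S) (F : Embedding S VE EE)

lemma sketch_mem_edgesOf {A : Finset (V ⊕ VE)} {e : EE} :
    Sum.inr (Sum.inr e) ∈ (D.withEmbedding F).edgesOf A ↔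
      (∃ u ∈ F.ends e, Sum.inr u ∈ A) ∧
        ((∃ u ∈ F.ends e, Sum.inr u ∉ A) ∨ (F.ends e).card = 1) := by
  simp [TensorNetwork.mem_edgesOf, withEmbedding]

lemma input_mem_edgesOf {A : Finset (V ⊕ VE)} {s : S} :
    Sum.inr (Sum.inl s) ∈ (D.withEmbedding F).edgesOf A ↔
      ¬ (Sum.inl (D.vertex s) ∈ A ↔ Sum.inr (F.input s) ∈ A) := by
  simp only [TensorNetwork.mem_edgesOf, withEmbedding, Finset.mem_insert, Finset.mem_singleton,
    exists_eq_or_imp, exists_eq_left, or_false]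
  tauto

/-- An upper bound on the cost of a contraction, from sets `X` and `Y` that contain the data edges
and the other edges of the operands. -/
lemma contractionCost_le {A B : Finset (V ⊕ VE)} (hAB : Disjoint A B) (X : Finset E)
    (Y : Finset (S ⊕ EE))
    (hX : ∀ e, Sum.inl e ∈ (D.withEmbedding F).edgesOf A ∨
      Sum.inl e ∈ (D.withEmbedding F).edgesOf B → e ∈ X)
    (hY : ∀ e, Sum.inr e ∈ (D.withEmbedding F).edgesOf A ∨
      Sum.inr e ∈ (D.withEmbedding F).edgesOf B → e ∈ Y) :
    (D.withEmbedding F).contractionCost A B ≤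
      (∏ e ∈ X, (D.rest.dim e : ℝ)) * ∏ e ∈ Y, ((D.withEmbedding F).dim (.inr e) : ℝ) := by
  rw [(D.withEmbedding F).contractionCost_eq hAB]
  refine ((D.withEmbedding F).prod_dim_mono (t := X.disjSum Y) ?_).trans (le_of_eq ?_)
  · rintro (e | e) he
    · exact Finset.inl_mem_disjSum.mpr (hX e (Finset.mem_union.mp he))
    · exact Finset.inr_mem_disjSum.mpr (hY e (Finset.mem_union.mp he))
  · rw [Finset.prod_disjSum]
    rfl

end DataNetwork

/-! ### The algorithm's contraction tree -/

namespace Alg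

open ContractionTree

variable {V E S : Type*} [Fintype E] (D : DataNetwork V E S)
  (hD : Function.Surjective D.vertex)

section treeAux

variable {X : Type*}

lemma inl_mem_treeAux {v : V} : ∀ (t : ContractionTree V) (f : t.Contraction → X),
    Sum.inl v ∈ (treeAux D hD t f).leaves ↔ v ∈ t.leaves
  | leaf w, f => by simp [treeAux, leaves]
  | node l r, f => by
      have hl := inl_mem_treeAux (v := v) l fun i => f (some (.inl i))
      have hr := inl_mem_treeAux (v := v) r fun i => f (some (.inr i))
      by_cases h : LeftFirst D l.verts r.verts
      · simp [treeAux, leaves, h, hl, hr]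
      · simp [treeAux, leaves, h, hl, hr, or_comm]

lemma inr_inl_mem_treeAux {s : S} : ∀ (t : ContractionTree V) (f : t.Contraction → X),
    Sum.inr (Sum.inl s) ∈ (treeAux D hD t f).leaves ↔ D.vertex s ∈ t.leaves
  | leaf w, f => by
      have : s = edgeAt D hD w ↔ D.vertex s = w :=
        ⟨fun h => h ▸ vertex_edgeAt D hD w, fun h => h ▸ (edgeAt_vertex D hD s).symm⟩
      simp [treeAux, leaves, this]
  | node l r, f => by
      have hl := inr_inl_mem_treeAux (s := s) l fun i => f (some (.inl i))
      have hr := inr_inl_mem_treeAux (s := s) r fun i => f (some (.inr i))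
      by_cases h : LeftFirst D l.verts r.verts
      · simp [treeAux, leaves, h, hl, hr]
      · simp [treeAux, leaves, h, hl, hr, or_comm]

lemma exists_contraction_node {l r : ContractionTree V} {p : (node l r).Contraction → Prop} :
    (∃ i, p i) ↔ p none ∨ (∃ i, p (some (.inl i))) ∨ ∃ i, p (some (.inr i)) := by
  constructor
  · rintro ⟨_ | i | i, h⟩
    · exact .inl h
    · exact .inr (.inl ⟨i, h⟩)
    · exact .inr (.inr ⟨i, h⟩)
  · rintro (h | ⟨i, h⟩ | ⟨i, h⟩)
    · exact ⟨none, h⟩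
    · exact ⟨some (.inl i), h⟩
    · exact ⟨some (.inr i), h⟩

lemma inr_inr_mem_treeAux {j : X} {k : Fin 2} : ∀ (t : ContractionTree V)
    (f : t.Contraction → X),
    Sum.inr (Sum.inr (j, k)) ∈ (treeAux D hD t f).leaves ↔ ∃ i, f i = j
  | leaf w, f => by
      simp only [treeAux, leaves, List.cons_append, List.nil_append, List.mem_cons, reduceCtorEq,
        Sum.inr.injEq, List.not_mem_nil, or_self, false_iff, not_exists]
      exact fun i => Empty.elim i
  | node l r, f => by
      have hl := inr_inr_mem_treeAux (j := j) (k := k) l fun i => f (some (.inl i))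
      have hr := inr_inr_mem_treeAux (j := j) (k := k) r fun i => f (some (.inr i))
      rw [exists_contraction_node]
      have hk : k = 0 ∨ k = 1 := by omega
      have hj : (j = f none) ↔ (f none = j) := eq_comm
      by_cases h : LeftFirst D l.verts r.verts <;>
      · simp only [treeAux, leaves, h, if_true, if_false, List.mem_append, hl, hr,
          List.mem_singleton, Sum.inr.injEq, Prod.mk.injEq, hj]
        rcases hk with rfl | rfl <;> simp <;> tauto

lemma nodup_treeAux : ∀ (t : ContractionTree V) (f : t.Contraction → X), t.leaves.Nodup →
    Function.Injective f → (treeAux D hD t f).leaves.Nodup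
  | leaf w, f, _, _ => by simp [treeAux, leaves]
  | node l r, f, h, hf => by
      obtain ⟨hl, hr, hd⟩ := nodup_node h
      have hfl : Function.Injective fun i => f (some (.inl i)) :=
        hf.comp ((Option.some_injective _).comp Sum.inl_injective)
      have hfr : Function.Injective fun i => f (some (.inr i)) :=
        hf.comp ((Option.some_injective _).comp Sum.inr_injective)
      have ihl := nodup_treeAux l _ hl hfl
      have ihr := nodup_treeAux r _ hr hfr
      have hL (k : Fin 2) : Sum.inr (Sum.inr (f none, k)) ∉
          (treeAux D hD l fun i => f (some (.inl i))).leaves := by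
        rw [inr_inr_mem_treeAux]
        rintro ⟨i, hi⟩
        exact Option.some_ne_none _ (hf hi)
      have hR (k : Fin 2) : Sum.inr (Sum.inr (f none, k)) ∉
          (treeAux D hD r fun i => f (some (.inr i))).leaves := by
        rw [inr_inr_mem_treeAux]
        rintro ⟨i, hi⟩
        exact Option.some_ne_none _ (hf hi)
      have hLR : ∀ x ∈ (treeAux D hD l fun i => f (some (.inl i))).leaves,
          x ∉ (treeAux D hD r fun i => f (some (.inr i))).leaves := by
        have hdis : ∀ v ∈ l.leaves, v ∉ r.leaves := fun v hv hv' =>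
          Finset.disjoint_left.mp hd (mem_verts.mpr hv) (mem_verts.mpr hv')
        rintro (v | s | ⟨j, k⟩) hx hy
        · rw [inl_mem_treeAux] at hx hy
          exact hdis v hx hy
        · rw [inr_inl_mem_treeAux] at hx hy
          exact hdis _ hx hy
        · rw [inr_inr_mem_treeAux] at hx hy
          obtain ⟨i, hi⟩ := hx
          obtain ⟨i', hi'⟩ := hy
          exact Sum.inl_ne_inr (Option.some_injective _ (hf (hi.trans hi'.symm)))
      have hRL : ∀ x ∈ (treeAux D hD r fun i => f (some (.inr i))).leaves,
          x ∉ (treeAux D hD l fun i => f (some (.inl i))).leaves :=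
        fun x hx hy => hLR x hy hx
      by_cases h : LeftFirst D l.verts r.verts
      · simp only [treeAux, leaves, h, if_true, List.nodup_append', ihl, ihr,
          List.nodup_singleton, List.disjoint_singleton, List.disjoint_append_left, true_and,
          and_true, hL, hR, not_false_iff, List.singleton_disjoint]
        exact ⟨fun x hx hy => hLR x hx hy, by simp [hL, hR]⟩
      · simp only [treeAux, leaves, h, if_false, List.nodup_append', ihl, ihr,
          List.nodup_singleton, List.disjoint_singleton, List.disjoint_append_left, true_and,
          and_true, hL, hR, not_false_iff, List.singleton_disjoint]
        exact ⟨fun x hx hy => hRL x hx hy, by simp [hL, hR]⟩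

lemma dataPart_treeAux (t : ContractionTree V) (f : t.Contraction → X) :
    dataPart (treeAux D hD t f).verts = t.verts := by
  ext v
  rw [mem_dataPart, mem_verts, inl_mem_treeAux, mem_verts]

lemma treeAux_node_of_leftFirst {l r : ContractionTree V} {f : (node l r).Contraction → X}
    (h : LeftFirst D l.verts r.verts) : treeAux D hD (node l r) f =
      node (node (node (treeAux D hD l fun i => f (some (.inl i)))
        (leaf (.inr (.inr (f none, 0))))) (treeAux D hD r fun i => f (some (.inr i))))
        (leaf (.inr (.inr (f none, 1)))) :=
  if_pos h

lemma treeAux_node_of_not_leftFirst {l r : ContractionTree V}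
    {f : (node l r).Contraction → X} (h : ¬ LeftFirst D l.verts r.verts) :
    treeAux D hD (node l r) f =
      node (node (node (treeAux D hD r fun i => f (some (.inr i)))
        (leaf (.inr (.inr (f none, 0))))) (treeAux D hD l fun i => f (some (.inl i))))
        (leaf (.inr (.inr (f none, 1)))) :=
  if_neg h

lemma dataPart_insert_first (t : ContractionTree V) (f : t.Contraction → X) (z : Vertex S X) :
    dataPart (node (treeAux D hD t f) (leaf (.inr z))).verts = t.verts := by
  ext v
  rw [mem_dataPart, mem_verts, leaves, List.mem_append, inl_mem_treeAux, mem_verts]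
  simp [leaves]

lemma mem_contractions_stage {W : Type*} {L R : ContractionTree W} {z z' : W}
    {q : Finset W × Finset W} (hq : q ∈ L.contractions ∨ q ∈ R.contractions) :
    q ∈ (node (node (node L (leaf z)) R) (leaf z')).contractions := by
  simp only [contractions, List.mem_cons, List.mem_append]
  tauto

/-- The middle contraction of each stage, of the first operand together with `(i, 0)` and the second
operand, realizes the data contraction, because small networks contain no data tensors. If the right
operand is first, the pair appears swapped. -/
lemma constrainedOn_treeAux : ∀ (t : ContractionTree V) (f : t.Contraction → X),
    (treeAux D hD t f).ConstrainedOn t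
  | leaf _, _ => fun p hp => by simp [contractions] at hp
  | node l r, f => fun p hp => by
      have hl := constrainedOn_treeAux l fun i => f (some (.inl i))
      have hr := constrainedOn_treeAux r fun i => f (some (.inr i))
      rw [contractions, List.mem_cons, List.mem_append] at hp
      by_cases h : LeftFirst D l.verts r.verts
      · rw [treeAux_node_of_leftFirst D hD h]
        rcases hp with rfl | hp | hp
        · exact ⟨_, List.mem_cons_of_mem _ (List.mem_append_left _ List.mem_cons_self),
            .inl ⟨dataPart_insert_first D hD _ _ _, dataPart_treeAux D hD _ _⟩⟩
        · obtain ⟨q, hq, hpq⟩ := hl p hp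
          exact ⟨q, mem_contractions_stage (.inl hq), hpq⟩
        · obtain ⟨q, hq, hpq⟩ := hr p hp
          exact ⟨q, mem_contractions_stage (.inr hq), hpq⟩
      · rw [treeAux_node_of_not_leftFirst D hD h]
        rcases hp with rfl | hp | hp
        · exact ⟨_, List.mem_cons_of_mem _ (List.mem_append_left _ List.mem_cons_self),
            .inr ⟨dataPart_insert_first D hD _ _ _, dataPart_treeAux D hD _ _⟩⟩
        · obtain ⟨q, hq, hpq⟩ := hl p hp
          exact ⟨q, mem_contractions_stage (.inr hq), hpq⟩
        · obtain ⟨q, hq, hpq⟩ := hr p hp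
          exact ⟨q, mem_contractions_stage (.inl hq), hpq⟩

end treeAux

variable (T : ContractionTree V)

lemma isFull_tree (hT : T.IsFull) : (tree D hD T).IsFull := by
  refine ⟨nodup_treeAux D hD T id hT.1 Function.injective_id, ?_⟩
  rintro (v | s | ⟨j, k⟩)
  · exact (inl_mem_treeAux D hD T id).mpr (hT.2 v)
  · exact (inr_inl_mem_treeAux D hD T id).mpr (hT.2 _)
  · exact (inr_inr_mem_treeAux D hD T id).mpr ⟨j, rfl⟩

variable {T} {m : ℕ} (hm : 0 < m) {t : ContractionTree V} {f : t.Contraction → T.Contraction}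

lemma outTensor_mem_treeAux {x : V ⊕ T.Contraction} :
    Sum.inr (outTensor D hD x) ∈ (treeAux D hD t f).leaves ↔
      ∃ y, t.IsNode y ∧ x = Sum.map id f y := by
  rcases x with v | j
  · rw [outTensor, inr_inl_mem_treeAux, vertex_edgeAt]
    constructor
    · exact fun h => ⟨.inl v, h, rfl⟩
    · rintro ⟨w | i, hw, h⟩
      · exact Sum.inl_injective h ▸ hw
      · exact (Sum.inl_ne_inr h).elim
  · rw [outTensor, inr_inr_mem_treeAux]
    constructor
    · rintro ⟨i, rfl⟩
      exact ⟨.inr i, trivial, rfl⟩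
    · rintro ⟨w | i, hw, h⟩
      · exact (Sum.inr_ne_inl h).elim
      · exact ⟨i, (Sum.inr_injective h).symm⟩

variable [Fintype S]

/-- The only edges of the embedding that leave the part of the network for a subtree are those that
carry the sketch dimension of its root. -/
lemma mem_outEdges_of_mem_edgesOf (hT : T.leaves.Nodup) (h : IsSubtree T t f)
    {e : S ⊕ Edge T.Contraction}
    (he : Sum.inr e ∈ (D.withEmbedding (embedding D hD T m hm)).edgesOf
      (treeAux D hD t f).verts) :
    ∃ e', e = .inr e' ∧ e' ∈ outEdges D T (Sum.map id f t.root) := by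
  have hchild : ∀ p : T.Contraction × Bool, p.1 ∈ Set.range f →
      Sum.inr (outTensor D hD (T.child p)) ∈ (treeAux D hD t f).verts := by
    rintro ⟨_, b⟩ ⟨i, rfl⟩
    rw [mem_verts, outTensor_mem_treeAux]
    exact ⟨_, t.isNode_child (i, b), h.child i b⟩
  have hz : ∀ j k, Sum.inr (Sum.inr (j, k)) ∈ (treeAux D hD t f).verts ↔ j ∈ Set.range f :=
    fun j k => by rw [mem_verts, inr_inr_mem_treeAux]; rfl
  have hroot : ∀ x : V ⊕ T.Contraction,
      (x = T.root ∨ ∃ p : T.Contraction × Bool, p.1 ∉ Set.range f ∧ x = T.child p) →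
      Sum.inr (outTensor D hD x) ∈ (treeAux D hD t f).verts → x = Sum.map id f t.root := by
    intro x hx hmem
    rw [mem_verts, outTensor_mem_treeAux] at hmem
    obtain ⟨y, hy, rfl⟩ := hmem
    rw [h.eq_root hT hy hx]
  rcases e with s | e
  -- A sketched edge joins a data tensor to its Kronecker factor, and the two always enter together.
  · rw [DataNetwork.input_mem_edgesOf, mem_verts, mem_verts, inl_mem_treeAux] at he
    exact (he (inr_inl_mem_treeAux D hD t f).symm).elim
  refine ⟨e, rfl, ?_⟩
  rw [DataNetwork.sketch_mem_edgesOf] at he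
  obtain ⟨⟨u, hu, hut⟩, hex⟩ := he
  rw [mem_outEdges]
  match e with
  | none =>
    obtain rfl := (mem_ends_none D hD hm).mp hu
    exact .inl ⟨rfl, (hroot _ (.inl rfl) hut).symm⟩
  | some (j, k) =>
    rw [card_ends_some, or_iff_left (by norm_num)] at hex
    obtain ⟨w, hw, hwt⟩ := hex
    -- If `j` belongs to the subtree, so do all ends of the edges of its small network, and none of
    -- them leaves. Otherwise the end inside is the output tensor of a child of `j`; having its
    -- parent outside, this child is the root of the subtree.
    by_cases hj : j ∈ Set.range f
    · refine (hwt ?_).elim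
      match k with
      | 0 =>
        rcases (mem_ends_zero D hD hm).mp hw with rfl | rfl
        · rw [firstChild_eq]
          exact hchild _ hj
        · exact (hz j _).mpr hj
      | 1 =>
        rcases (mem_ends_one D hD hm).mp hw with rfl | rfl
        · rw [secondChild_eq]
          exact hchild _ hj
        · exact (hz j _).mpr hj
      | 2 =>
        rcases (mem_ends_two D hD hm).mp hw with rfl | rfl
        · rw [secondChild_eq]
          exact hchild _ hj
        · exact (hz j _).mpr hj
      | 3 => rcases (mem_ends_three D hD hm).mp hw with rfl | rfl <;> exact (hz j _).mpr hj
    · match k with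
      | 0 =>
        rcases (mem_ends_zero D hD hm).mp hu with rfl | rfl
        · exact .inr (.inl ⟨j, rfl, (hroot _ (.inr ⟨_, hj, firstChild_eq D T j⟩) hut).symm⟩)
        · exact (hj ((hz j _).mp hut)).elim
      | 1 =>
        rcases (mem_ends_one D hD hm).mp hu with rfl | rfl
        · exact .inr (.inr ⟨j, .inl rfl,
            (hroot _ (.inr ⟨_, hj, secondChild_eq D T j⟩) hut).symm⟩)
        · exact (hj ((hz j _).mp hut)).elim
      | 2 =>
        rcases (mem_ends_two D hD hm).mp hu with rfl | rfl
        · exact .inr (.inr ⟨j, .inr rfl,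
            (hroot _ (.inr ⟨_, hj, secondChild_eq D T j⟩) hut).symm⟩)
        · exact (hj ((hz j _).mp hut)).elim
      | 3 =>
        rcases (mem_ends_three D hD hm).mp hu with rfl | rfl <;>
          exact (hj ((hz j _).mp hut)).elim

/-- The edges of the embedding at the first tensor of a small network. -/
lemma eq_of_mem_edgesOf_first {i : T.Contraction} {e : S ⊕ Edge T.Contraction}
    (he : Sum.inr e ∈ (D.withEmbedding (embedding D hD T m hm)).edgesOf
      {.inr (.inr (i, 0))}) :
    e = .inr (some (i, 0)) ∨ e = .inr (some (i, 1)) ∨ e = .inr (some (i, 3)) := by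
  rcases e with s | e
  · rw [DataNetwork.input_mem_edgesOf] at he
    simp [embedding] at he
  rw [DataNetwork.sketch_mem_edgesOf] at he
  obtain ⟨⟨u, hu, hut⟩, -⟩ := he
  obtain rfl := Sum.inr_injective (Finset.mem_singleton.mp hut)
  match e with
  | none => exact (outTensor_ne_first D hD _ _ ((mem_ends_none D hD hm).mp hu).symm).elim
  | some (j, 0) =>
    rcases (mem_ends_zero D hD hm).mp hu with h | h
    · exact (outTensor_ne_first D hD _ _ h.symm).elim
    · obtain ⟨rfl, -⟩ := Prod.mk.inj (Sum.inr_injective h)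
      exact .inl rfl
  | some (j, 1) =>
    rcases (mem_ends_one D hD hm).mp hu with h | h
    · exact (outTensor_ne_first D hD _ _ h.symm).elim
    · obtain ⟨rfl, -⟩ := Prod.mk.inj (Sum.inr_injective h)
      exact .inr (.inl rfl)
  | some (j, 2) =>
    rcases (mem_ends_two D hD hm).mp hu with h | h
    · exact (outTensor_ne_first D hD _ _ h.symm).elim
    · simp at h
  | some (j, 3) =>
    rcases (mem_ends_three D hD hm).mp hu with h | h
    · obtain ⟨rfl, -⟩ := Prod.mk.inj (Sum.inr_injective h)
      exact .inr (.inr rfl)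
    · simp at h

/-- The edges of the embedding at the tensor that carries the output of a vertex of the tree are
its output edges, and the two last edges of the small network or the edge to be sketched. -/
lemma mem_of_mem_edgesOf_outTensor {x : V ⊕ T.Contraction} {e : S ⊕ Edge T.Contraction}
    (he : Sum.inr e ∈ (D.withEmbedding (embedding D hD T m hm)).edgesOf
      {.inr (outTensor D hD x)}) :
    (∃ e', e = .inr e' ∧ e' ∈ outEdges D T x) ∨ (∃ v, x = .inl v ∧ e = .inl (edgeAt D hD v)) ∨
      ∃ i, x = .inr i ∧ (e = .inr (some (i, 2)) ∨ e = .inr (some (i, 3))) := by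
  rcases e with s | e
  · rw [DataNetwork.input_mem_edgesOf] at he
    rcases x with v | i
    · refine .inr (.inl ⟨v, rfl, ?_⟩)
      simpa [embedding, outTensor] using he
    · simp [embedding, outTensor] at he
  rw [DataNetwork.sketch_mem_edgesOf] at he
  obtain ⟨⟨u, hu, hut⟩, -⟩ := he
  obtain rfl := Sum.inr_injective (Finset.mem_singleton.mp hut)
  have inj : Function.Injective (outTensor D hD : V ⊕ T.Contraction → _) :=
    outTensor_injective D hD
  have hlast {j : T.Contraction} (h : outTensor D hD x = .inr (j, 1)) : x = .inr j :=
    inj (h.trans rfl)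
  match e with
  | none =>
    exact .inl ⟨_, rfl, (mem_outEdges D T).mpr
      (.inl ⟨rfl, inj ((mem_ends_none D hD hm).mp hu)⟩)⟩
  | some (j, 0) =>
    rcases (mem_ends_zero D hD hm).mp hu with h | h
    · exact .inl ⟨_, rfl, (mem_outEdges D T).mpr (.inr (.inl ⟨j, rfl, inj h⟩))⟩
    · exact (outTensor_ne_first D hD _ _ h).elim
  | some (j, 1) =>
    rcases (mem_ends_one D hD hm).mp hu with h | h
    · exact .inl ⟨_, rfl, (mem_outEdges D T).mpr (.inr (.inr ⟨j, .inl rfl, inj h⟩))⟩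
    · exact (outTensor_ne_first D hD _ _ h).elim
  | some (j, 2) =>
    rcases (mem_ends_two D hD hm).mp hu with h | h
    · exact .inl ⟨_, rfl, (mem_outEdges D T).mpr (.inr (.inr ⟨j, .inr rfl, inj h⟩))⟩
    · exact .inr (.inr ⟨j, hlast h, .inl rfl⟩)
  | some (j, 3) =>
    rcases (mem_ends_three D hD hm).mp hu with h | h
    · exact (outTensor_ne_first D hD _ _ h).elim
    · exact .inr (.inr ⟨j, hlast h, .inr rfl⟩)

end Alg

lemma TensorNetwork.prod_dim_union_le {V E : Type*} [DecidableEq E] (G : TensorNetwork V E)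
    (s t : Finset E) :
    ∏ e ∈ s ∪ t, (G.dim e : ℝ) ≤ (∏ e ∈ s, (G.dim e : ℝ)) * ∏ e ∈ t, (G.dim e : ℝ) := by
  rw [← Finset.prod_union_inter]
  exact le_mul_of_one_le_right (zero_le_one.trans (G.one_le_prod_dim _)) (G.one_le_prod_dim _)

/-! ### Upper bound for the cost of the algorithm -/

namespace Alg

open ContractionTree

variable {V E S : Type*} [Fintype E] [Fintype S] (D : DataNetwork V E S)
  (hD : Function.Surjective D.vertex) {T : ContractionTree V} {m : ℕ} (hm : 0 < m)

lemma not_mem_edgesOf_of_ends {A : Finset (V ⊕ Vertex S T.Contraction)}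
    {p : T.Contraction × Fin 4}
    (h : ∀ u ∈ (embedding D hD T m hm).ends (some p), Sum.inr u ∈ A) :
    Sum.inr (Sum.inr (some p)) ∉ (D.withEmbedding (embedding D hD T m hm)).edgesOf A := by
  rw [DataNetwork.sketch_mem_edgesOf, card_ends_some]
  rintro ⟨-, ⟨u, hu, hu'⟩ | h'⟩
  · exact hu' (h u hu)
  · norm_num at h'

lemma inl_notMem_edgesOf_singleton {e : E} (u : Vertex S T.Contraction) :
    Sum.inl e ∉ (D.withEmbedding (embedding D hD T m hm)).edgesOf {.inr u} := by
  rw [DataNetwork.inl_mem_edgesOf]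
  simp [TensorNetwork.mem_edgesOf, dataPart]

/-- The cost of the three contractions that sketch the result of one contraction of the data. -/
lemma cost_stage_le (hT : T.leaves.Nodup) {P Q : ContractionTree V}
    {f : P.Contraction → T.Contraction} {g : Q.Contraction → T.Contraction}
    (hP : IsSubtree T P f) (hQ : IsSubtree T Q g) {i : T.Contraction}
    (hfirst : firstChild D T i = Sum.map id f P.root)
    (hsecond : secondChild D T i = Sum.map id g Q.root)
    (hPv : firstVerts D T i = P.verts) (hQv : secondVerts D T i = Q.verts)
    (hPQ : Disjoint P.verts Q.verts)
    (hnd : (node (node (node (treeAux D hD P f) (leaf (.inr (.inr (i, 0)))))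
      (treeAux D hD Q g)) (leaf (.inr (.inr (i, 1))))).leaves.Nodup) :
    (node (node (node (treeAux D hD P f) (leaf (.inr (.inr (i, 0)))))
      (treeAux D hD Q g)) (leaf (.inr (.inr (i, 1))))).cost
        (D.withEmbedding (embedding D hD T m hm)) ≤
      D.stageCost m (firstVerts D T i) (secondVerts D T i) +
      ((treeAux D hD P f).cost (D.withEmbedding (embedding D hD T m hm)) +
        (treeAux D hD Q g).cost (D.withEmbedding (embedding D hD T m hm))) := by
  set G := D.withEmbedding (embedding D hD T m hm) with hG
  set L := treeAux D hD P f
  set R := treeAux D hD Q g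
  obtain ⟨hnd₂, -, hd₃⟩ := nodup_node hnd
  obtain ⟨hnd₁, -, hd₂⟩ := nodup_node hnd₂
  obtain ⟨-, -, hd₁⟩ := nodup_node hnd₁
  have hdim0 : G.dim (.inr (.inr (some (i, 0)))) = m := rfl
  have hdim1 : G.dim (.inr (.inr (some (i, 1)))) =
    D.splitSize m (firstVerts D T i) (secondVerts D T i) := rfl
  have hdim2 : G.dim (.inr (.inr (some (i, 2)))) =
    D.cosplitSize m (firstVerts D T i) (secondVerts D T i) := rfl
  have hdim3 : G.dim (.inr (.inr (some (i, 3)))) = m := rfl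
  have hLe {e} (he : Sum.inr e ∈ G.edgesOf L.verts) : e = .inr (some (i, 0)) := by
    obtain ⟨e', rfl, he'⟩ := mem_outEdges_of_mem_edgesOf D hD hm hT hP he
    rw [← hfirst, outEdges_firstChild D hT, Finset.mem_singleton] at he'
    rw [he']
  have hRe {e} (he : Sum.inr e ∈ G.edgesOf R.verts) :
      e = .inr (some (i, 1)) ∨ e = .inr (some (i, 2)) := by
    obtain ⟨e', rfl, he'⟩ := mem_outEdges_of_mem_edgesOf D hD hm hT hQ he
    rw [← hsecond, outEdges_secondChild D hT, Finset.mem_insert, Finset.mem_singleton] at he'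
    rcases he' with rfl | rfl
    · exact .inl rfl
    · exact .inr rfl
  have hLroot : Sum.inr (outTensor D hD (firstChild D T i)) ∈ L.verts := by
    rw [mem_verts, outTensor_mem_treeAux]
    exact ⟨_, P.isNode_root, hfirst⟩
  have hRroot : Sum.inr (outTensor D hD (secondChild D T i)) ∈ R.verts := by
    rw [mem_verts, outTensor_mem_treeAux]
    exact ⟨_, Q.isNode_root, hsecond⟩
  have hdp : dataPart (node L (leaf (.inr (.inr (i, 0))))).verts = P.verts :=
    dataPart_insert_first D hD P f _
  have hdp₂ : dataPart (node (node L (leaf (.inr (.inr (i, 0))))) R).verts =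
      P.verts ∪ Q.verts := by
    rw [verts_node, dataPart_union, hdp, dataPart_treeAux]
  have hzL : Sum.inr (Sum.inr (i, 0)) ∈ (node L (leaf (.inr (.inr (i, 0))))).verts := by
    rw [mem_verts]
    simp [leaves]
  have hsubL : L.verts ⊆ (node L (leaf (.inr (.inr (i, 0))))).verts := by
    rw [verts_node]
    exact Finset.subset_union_left
  -- Absorbing `(i, 0)` sums over the edge of size m to the first operand; what remains are the edge
  -- of size α and the one to `(i, 1)`.
  have hLz {e} (he : Sum.inr e ∈ G.edgesOf (node L (leaf (.inr (.inr (i, 0))))).verts) :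
      e = .inr (some (i, 1)) ∨ e = .inr (some (i, 3)) := by
    have h0 : e ≠ .inr (some (i, 0)) := by
      rintro rfl
      refine not_mem_edgesOf_of_ends D hD hm (fun u hu => ?_) he
      rcases (mem_ends_zero D hD hm).mp hu with rfl | rfl
      · exact hsubL hLroot
      · exact hzL
    rw [verts_node, verts_leaf] at he
    rcases Finset.mem_union.mp (G.edgesOf_union_subset _ _ he) with he | he
    · exact (h0 (hLe he)).elim
    · exact (eq_of_mem_edgesOf_first D hD hm he).resolve_left h0
  have h₁ : G.contractionCost L.verts (leaf (.inr (.inr (i, 0)))).verts ≤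
      Real.exp (D.rest.cut P.verts) *
        (m * D.splitSize m (firstVerts D T i) (secondVerts D T i) * m) := by
    refine (D.contractionCost_le _ hd₁ (D.rest.edgesOf P.verts)
      {.inr (some (i, 0)), .inr (some (i, 1)), .inr (some (i, 3))} (fun e he => ?_)
      fun e he => ?_).trans (le_of_eq ?_)
    · rw [verts_leaf] at he
      rcases he with he | he
      · rwa [DataNetwork.inl_mem_edgesOf, dataPart_treeAux] at he
      · exact (inl_notMem_edgesOf_singleton D hD hm _ he).elim
    · rw [verts_leaf] at he
      simp only [Finset.mem_insert, Finset.mem_singleton]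
      rcases he with he | he
      · exact .inl (hLe he)
      · exact eq_of_mem_edgesOf_first D hD hm he
    · rw [← D.rest.exp_cut, Finset.prod_insert (by simp), Finset.prod_pair (by simp), ← hG, hdim0,
        hdim1, hdim3]
      ring
  have h₂ : G.contractionCost (node L (leaf (.inr (.inr (i, 0))))).verts R.verts ≤
      D.rest.contractionCost P.verts Q.verts *
        (D.splitSize m (firstVerts D T i) (secondVerts D T i) *
          D.cosplitSize m (firstVerts D T i) (secondVerts D T i) * m) := by
    refine (D.contractionCost_le _ hd₂ (D.rest.edgesOf P.verts ∪ D.rest.edgesOf Q.verts)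
      {.inr (some (i, 1)), .inr (some (i, 2)), .inr (some (i, 3))} (fun e he => ?_)
      fun e he => ?_).trans (le_of_eq ?_)
    · rwa [DataNetwork.inl_mem_edgesOf, DataNetwork.inl_mem_edgesOf, dataPart_treeAux, hdp,
        ← Finset.mem_union] at he
    · simp only [Finset.mem_insert, Finset.mem_singleton]
      rcases he with he | he
      · have := hLz he
        tauto
      · have := hRe he
        tauto
    · rw [← D.rest.contractionCost_eq hPQ, Finset.prod_insert (by simp),
        Finset.prod_pair (by simp), ← hG, hdim1, hdim2, hdim3]
      ring
  have h₃ : G.contractionCost (node (node L (leaf (.inr (.inr (i, 0))))) R).verts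
      (leaf (.inr (.inr (i, 1)))).verts ≤
      Real.exp (D.rest.cut (P.verts ∪ Q.verts)) *
        (D.cosplitSize m (firstVerts D T i) (secondVerts D T i) * m * (2 * m)) := by
    have hmem {e} (he : Sum.inr e ∈
        G.edgesOf (node (node L (leaf (.inr (.inr (i, 0))))) R).verts) :
        e = .inr (some (i, 2)) ∨ e = .inr (some (i, 3)) := by
      -- The edge of size α is summed over once the second operand is absorbed.
      have h1 : e ≠ .inr (some (i, 1)) := by
        rintro rfl
        refine not_mem_edgesOf_of_ends D hD hm (fun u hu => ?_) he
        rw [verts_node, Finset.mem_union]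
        rcases (mem_ends_one D hD hm).mp hu with rfl | rfl
        · exact .inr hRroot
        · exact .inl hzL
      rw [verts_node] at he
      rcases Finset.mem_union.mp (G.edgesOf_union_subset _ _ he) with he | he
      · exact .inr ((hLz he).resolve_left h1)
      · exact .inl ((hRe he).resolve_left h1)
    refine (D.contractionCost_le _ hd₃ (D.rest.edgesOf (P.verts ∪ Q.verts))
      ({.inr (some (i, 2)), .inr (some (i, 3))} ∪
        (outEdges D T (.inr i)).map Function.Embedding.inr) (fun e he => ?_)
      fun e he => ?_).trans ?_
    · rw [verts_leaf] at he
      rcases he with he | he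
      · rwa [DataNetwork.inl_mem_edgesOf, hdp₂] at he
      · exact (inl_notMem_edgesOf_singleton D hD hm _ he).elim
    · rw [verts_leaf] at he
      simp only [Finset.mem_union, Finset.mem_insert, Finset.mem_singleton, Finset.mem_map]
      rcases he with he | he
      · exact .inl (hmem he)
      · rcases mem_of_mem_edgesOf_outTensor D hD hm (x := .inr i) he with
          ⟨e', rfl, he'⟩ | ⟨v, hv, -⟩ | ⟨j, hj, hej⟩
        · exact .inr ⟨e', he', rfl⟩
        · exact (Sum.inr_ne_inl hv).elim
        · obtain rfl := Sum.inr_injective hj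
          exact .inl hej
    · rw [← D.rest.exp_cut]
      refine mul_le_mul_of_nonneg_left ?_ (Real.exp_pos _).le
      -- The last tensor adds the output edges of the stage. They have total size at most 2m, as the
      -- output may itself be split for the next stage.
      have hu := G.prod_dim_union_le
        (({.inr (some (i, 2)), .inr (some (i, 3))} : Finset (S ⊕ Edge T.Contraction)).map
          Function.Embedding.inr)
        (((outEdges D T (.inr i)).map Function.Embedding.inr).map Function.Embedding.inr)
      rw [← Finset.map_union, Finset.prod_map, Finset.prod_map, Finset.prod_map,
        Finset.prod_map, Finset.prod_pair (by simp)] at hu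
      refine hu.trans ?_
      have ho := (prod_outEdges D hD hm hT (x := .inr i) trivial).2
      exact mul_le_mul_of_nonneg_left ho (by positivity)
  rw [cost_node, cost_node, cost_node, cost_leaf, cost_leaf, DataNetwork.stageCost,
    ← D.exp_cut_eq, ← D.exp_cut_union_eq]
  rw [← hPv] at h₁ h₂ h₃
  rw [← hQv] at h₂ h₃
  linarith

/-- The indices are those of the data tensor, its sketched edge and the output of the Kronecker
factor; the factor 2 allows for a split output. -/
lemma cost_leaf_le (hT : T.leaves.Nodup) (v : V) (f : (leaf v).Contraction → T.Contraction)
    (hv : v ∈ T.leaves) :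
    (treeAux D hD (leaf v) f).cost (D.withEmbedding (embedding D hD T m hm)) ≤
      2 * (Real.exp (D.rest.cut {v}) * D.size (edgeAt D hD v) * m) := by
  set G := D.withEmbedding (embedding D hD T m hm) with hG
  have hd : Disjoint (leaf (.inl v) : ContractionTree (V ⊕ Vertex S T.Contraction)).verts
      (leaf (.inr (.inl (edgeAt D hD v)))).verts := by
    rw [verts_leaf, verts_leaf]
    simp
  rw [treeAux, cost_node, cost_leaf, cost_leaf, add_zero, add_zero]
  refine (D.contractionCost_le _ hd (D.rest.edgesOf {v})
    ({.inl (edgeAt D hD v)} ∪ (outEdges D T (.inl v)).map Function.Embedding.inr)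
    (fun e he => ?_) fun e he => ?_).trans ?_
  · rw [verts_leaf, verts_leaf] at he
    rcases he with he | he
    · rw [DataNetwork.inl_mem_edgesOf] at he
      convert he
      ext w
      simp [mem_dataPart]
    · exact (inl_notMem_edgesOf_singleton D hD hm _ he).elim
  · rw [verts_leaf, verts_leaf] at he
    simp only [Finset.mem_union, Finset.mem_singleton, Finset.mem_map]
    rcases he with he | he
    · rcases e with s | e
      · rw [DataNetwork.input_mem_edgesOf] at he
        have hs : D.vertex s = v := by simpa using he
        exact .inl (by rw [← hs, edgeAt_vertex])
      · rw [DataNetwork.sketch_mem_edgesOf] at he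
        simp at he
    · rcases mem_of_mem_edgesOf_outTensor D hD hm (x := .inl v) he with
        ⟨e', rfl, he'⟩ | ⟨w, hw, he'⟩ | ⟨j, hj, -⟩
      · exact .inr ⟨e', he', rfl⟩
      · obtain rfl := Sum.inl_injective hw
        exact .inl he'
      · exact (Sum.inl_ne_inr hj).elim
  · rw [← D.rest.exp_cut]
    have hu := G.prod_dim_union_le
      (({.inl (edgeAt D hD v)} : Finset (S ⊕ Edge T.Contraction)).map Function.Embedding.inr)
      (((outEdges D T (.inl v)).map Function.Embedding.inr).map Function.Embedding.inr)
    rw [← Finset.map_union, Finset.prod_map, Finset.prod_map, Finset.prod_map,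
      Finset.prod_map, Finset.prod_singleton] at hu
    have ho := (prod_outEdges D hD hm hT (x := .inl v) hv).2
    have hs : (0 : ℝ) ≤ D.size (edgeAt D hD v) := Nat.cast_nonneg _
    calc _ ≤ Real.exp (D.rest.cut {v}) * (D.size (edgeAt D hD v) * (2 * m)) :=
          mul_le_mul_of_nonneg_left (hu.trans (mul_le_mul_of_nonneg_left ho hs))
            (Real.exp_pos _).le
      _ = _ := by ring

/-- Induction over subtrees, adding one stage at each contraction. The embedding remains that of the
whole tree `T`, so `f` is needed to locate the small networks of the subtree in it. -/
lemma cost_treeAux_le (hT : T.leaves.Nodup) : ∀ (t : ContractionTree V)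
    (f : t.Contraction → T.Contraction), IsSubtree T t f → t.leaves.Nodup →
    (∀ v ∈ t.leaves, v ∈ T.leaves) →
    (treeAux D hD t f).cost (D.withEmbedding (embedding D hD T m hm)) ≤
      2 * (t.leaves.map fun v => Real.exp (D.rest.cut {v}) * D.size (edgeAt D hD v) * m).sum +
      ∑ i, D.stageCost m (firstVerts D T (f i)) (secondVerts D T (f i))
  | leaf v, f, hf, _, hv => by
      have h := cost_leaf_le D hD hm hT v f (hv v (List.mem_singleton_self v))
      have h0 : ∑ i, D.stageCost m (firstVerts D T (f i)) (secondVerts D T (f i)) = 0 :=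
        Finset.sum_empty
      rw [h0]
      simpa [leaves] using h
  | node l r, f, hf, ht, hv => by
      obtain ⟨hl, hr, hd⟩ := nodup_node ht
      have ihl := cost_treeAux_le hT l _ hf.left hl fun v h => hv v (List.mem_append_left _ h)
      have ihr := cost_treeAux_le hT r _ hf.right hr fun v h => hv v (List.mem_append_right _ h)
      have hnd := nodup_treeAux D hD (node l r) f ht hf.injective
      have hlv : T.leftVerts (f none) = l.verts := hf.leftVerts none
      have hrv : T.rightVerts (f none) = r.verts := hf.rightVerts none
      have hlc : T.leftChild (f none) = Sum.map id (fun i => f (some (.inl i))) l.root :=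
        (hf.child none false).trans (Sum.map_map _ _ _ _ _)
      have hrc : T.rightChild (f none) = Sum.map id (fun i => f (some (.inr i))) r.root :=
        (hf.child none true).trans (Sum.map_map _ _ _ _ _)
      rw [sum_node, leaves, List.map_append, List.sum_append]
      by_cases h : LeftFirst D l.verts r.verts
      · rw [treeAux_node_of_leftFirst D hD h] at hnd ⊢
        have := cost_stage_le D hD hm hT hf.left hf.right
          (by rw [firstChild, hlv, hrv, if_pos h, hlc])
          (by rw [secondChild, hlv, hrv, if_pos h, hrc])
          (by rw [firstVerts, hlv, hrv, if_pos h]) (by rw [secondVerts, hlv, hrv, if_pos h])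
          hd hnd
        linarith
      · rw [treeAux_node_of_not_leftFirst D hD h] at hnd ⊢
        have := cost_stage_le D hD hm hT hf.right hf.left
          (by rw [firstChild, hlv, hrv, if_neg h, hrc])
          (by rw [secondChild, hlv, hrv, if_neg h, hlc])
          (by rw [firstVerts, hlv, hrv, if_neg h]) (by rw [secondVerts, hlv, hrv, if_neg h])
          hd.symm hnd
        linarith

lemma cost_tree_le (hT : T.leaves.Nodup) :
    (tree D hD T).cost (D.withEmbedding (embedding D hD T m hm)) ≤
      2 * (T.leaves.map fun v => Real.exp (D.rest.cut {v}) * D.size (edgeAt D hD v) * m).sum +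
      ∑ i, D.stageCost m (firstVerts D T i) (secondVerts D T i) :=
  cost_treeAux_le D hD hm hT T id (IsSubtree.refl T) hT fun _ h => h

end Alg

/-- A function to the natural numbers can be refined to an injective one. -/
lemma exists_injective_refinement {α : Type*} [Fintype α] (key : α → ℕ) :
    ∃ ord : α → ℕ, Function.Injective ord ∧ ∀ a b, key a < key b → ord a < ord b := by
  -- Lexicographic order: ties in `key` are broken by an enumeration with values below the
  -- cardinality.
  let idx : α → ℕ := fun a => Fintype.equivFin α a
  have hidx : ∀ a, idx a < Fintype.card α := fun a => (Fintype.equivFin α a).isLt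
  have hlt : ∀ a b, key a < key b →
      key a * Fintype.card α + idx a < key b * Fintype.card α + idx b := fun a b h => by
    have h₁ : (key a + 1) * Fintype.card α ≤ key b * Fintype.card α := Nat.mul_le_mul_right _ h
    have := hidx a
    rw [add_mul, one_mul] at h₁
    omega
  refine ⟨fun a => key a * Fintype.card α + idx a, fun a b hab => ?_, hlt⟩
  have hkey : key a = key b := by
    rcases lt_trichotomy (key a) (key b) with h | h | h
    · exact ((hlt a b h).ne hab).elim
    · exact h
    · exact ((hlt b a h).ne hab.symm).elim
  have h : idx a = idx b := by
    simp only [hkey] at hab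
    omega
  exact (Fintype.equivFin α).injective (Fin.ext h)

lemma Embedding.prod_le_rowSize {S VE EE : Type*} [Fintype EE] (F : Embedding S VE EE)
    {ord : VE → ℕ} {v : VE} {Y : Finset EE} (hY : ∀ e ∈ Y, v ∈ F.ends e ∧
      ((F.ends e).card = 1 ∨ ∃ u ∈ F.ends e, ord v < ord u)) :
    ∏ e ∈ Y, F.dim e ≤ F.rowSize ord v :=
  Nat.le_of_dvd (Finset.prod_pos fun e _ => F.dim_pos e)
    (Finset.prod_dvd_prod_of_subset _ _ _ fun e he =>
      Finset.mem_filter.mpr ⟨Finset.mem_univ e, hY e he⟩)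

/-! ### Membership of the algorithm's embedding in the class -/

namespace Alg

open ContractionTree

variable {V E S : Type*}

/-- There are N Kronecker factors and two tensors for each of the N − 1 contractions. -/
lemma card_vertex [Fintype S] {D : DataNetwork V E S}
    (hD : Function.Surjective D.vertex) {T : ContractionTree V} (hT : T.IsFull) :
    (Fintype.card (Vertex S T.Contraction) : ℝ) = 3 * Fintype.card S - 2 := by
  have h₁ := T.card_contraction
  have h₂ : Fintype.card S = T.leaves.length := by
    rw [← List.toFinset_card_of_nodup hT.1, ← Finset.card_univ]
    refine Finset.card_bij (fun s _ => D.vertex s) (fun s _ => List.mem_toFinset.mpr (hT.2 _))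
      (fun s _ s' _ h => D.vertex_injective h) fun v _ => ?_
    obtain ⟨s, rfl⟩ := hD v
    exact ⟨s, Finset.mem_univ s, rfl⟩
  have h₃ : Fintype.card (Vertex S T.Contraction) =
      Fintype.card S + Fintype.card T.Contraction * 2 := by
    rw [Fintype.card_sum, Fintype.card_prod, Fintype.card_fin]
  rw [h₃, h₂, ← h₁]
  push_cast
  ring

variable (D : DataNetwork V E S) (hD : Function.Surjective D.vertex) {T : ContractionTree V}

/-- The position of an embedding tensor: the Kronecker factors come first, and the small networks
are ordered by the number of data tensors that they sketch. -/
noncomputable def key : Vertex S T.Contraction → ℕ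
  | .inl _ => 0
  | .inr (i, k) => 2 * (T.nodeVerts (.inr i)).card + k

/-- The factor 2 in the position leaves room for both tensors of a small network: a strictly smaller
child stays below its parent even when its own last tensor is compared with the parent's first. -/
lemma key_outTensor_lt (hT : T.leaves.Nodup) (p : T.Contraction × Bool) (k : Fin 2) :
    key (outTensor D hD (T.child p)) < key (.inr (p.1, k) : Vertex S T.Contraction) := by
  have h := T.card_nodeVerts_child_lt hT p
  rcases hx : T.child p with v | j
  · simp only [outTensor, key]
    omega
  · rw [hx] at h
    simp only [outTensor, key]
    omega

variable {m : ℕ} (hm : 0 < m) [Fintype E]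

lemma outputs_embedding : (embedding D hD T m hm).outputs = {none} := by
  ext e
  rw [Embedding.outputs, Finset.mem_filter, Finset.mem_singleton]
  rcases e with _ | p
  · simp [embedding]
  · simp [card_ends_some]

lemma sketchSize_embedding : (embedding D hD T m hm).sketchSize = m := by
  rw [Embedding.sketchSize, outputs_embedding, Finset.prod_singleton]
  rfl

variable [Fintype S]

/-- Output tensors send their sketch to the small network of the parent, which comes later, or to
the free output; the total size is at least m even when it is split. The first tensor of a small
network has the edge of size m to the second. -/
lemma exists_ord_rowSize (hT : T.IsFull) : ∃ ord : Vertex S T.Contraction → ℕ,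
    Function.Injective ord ∧ ∀ v, m ≤ (embedding D hD T m hm).rowSize ord v := by
  obtain ⟨ord, hinj, hord⟩ := exists_injective_refinement (key (S := S) (T := T))
  have hlt (p : T.Contraction × Bool) (k : Fin 2) :
      ord (outTensor D hD (T.child p)) < ord (.inr (p.1, k)) :=
    hord _ _ (key_outTensor_lt D hD hT.1 p k)
  have hle {v : Vertex S T.Contraction} {Y : Finset (Edge T.Contraction)}
      (hY : ∀ e ∈ Y, v ∈ (embedding D hD T m hm).ends e ∧
        (((embedding D hD T m hm).ends e).card = 1 ∨
          ∃ u ∈ (embedding D hD T m hm).ends e, ord v < ord u))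
      (hm' : m ≤ ∏ e ∈ Y, (embedding D hD T m hm).dim e) :
      m ≤ (embedding D hD T m hm).rowSize ord v :=
    hm'.trans (Embedding.prod_le_rowSize _ hY)
  have hout (x : V ⊕ T.Contraction) (hx : T.IsNode x) :
      m ≤ (embedding D hD T m hm).rowSize ord (outTensor D hD x) := by
    refine hle (Y := outEdges D T x) (fun e he => ?_) (prod_outEdges D hD hm hT.1 hx).1
    rcases (mem_outEdges D T).mp he with ⟨rfl, rfl⟩ | ⟨i, rfl, rfl⟩ | ⟨i, rfl | rfl, rfl⟩
    · exact ⟨(mem_ends_none D hD hm).mpr rfl, .inl (Finset.card_singleton _)⟩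
    · refine ⟨(mem_ends_zero D hD hm).mpr (.inl rfl), .inr
        ⟨_, (mem_ends_zero D hD hm).mpr (.inr rfl), ?_⟩⟩
      rw [firstChild_eq]
      exact hlt _ _
    · refine ⟨(mem_ends_one D hD hm).mpr (.inl rfl), .inr
        ⟨_, (mem_ends_one D hD hm).mpr (.inr rfl), ?_⟩⟩
      rw [secondChild_eq]
      exact hlt _ _
    · refine ⟨(mem_ends_two D hD hm).mpr (.inl rfl), .inr
        ⟨_, (mem_ends_two D hD hm).mpr (.inr rfl), ?_⟩⟩
      rw [secondChild_eq]
      exact hlt _ _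
  refine ⟨ord, hinj, ?_⟩
  rintro (s | ⟨i, k⟩)
  · have h := hout (.inl (D.vertex s)) (hT.2 _)
    rwa [outTensor, edgeAt_vertex] at h
  · match k with
    | 0 =>
      refine hle (Y := {some (i, 3)}) (fun e he => ?_)
        (by rw [Finset.prod_singleton]; exact le_rfl)
      obtain rfl := Finset.mem_singleton.mp he
      exact ⟨(mem_ends_three D hD hm).mpr (.inl rfl), .inr
        ⟨_, (mem_ends_three D hD hm).mpr (.inr rfl), hord _ _ (by simp [key])⟩⟩
    | 1 => exact hout (.inr i) trivial

lemma inClass_embedding (hT : T.IsFull) {c₁ c₂ ε δ : ℝ}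
    (h₁ : c₁ * scale ε δ (3 * Fintype.card S - 2) ≤ m)
    (h₂ : m ≤ c₂ * scale ε δ (3 * Fintype.card S - 2)) :
    (embedding D hD T m hm).InClass c₁ c₂ ε δ where
  one_output := by rw [outputs_embedding, Finset.card_singleton]
  accurate := by
    obtain ⟨ord, hinj, hord⟩ := exists_ord_rowSize D hD hm hT
    refine ⟨ord, hinj, fun v => ?_⟩
    rw [card_vertex hD hT]
    exact h₁.trans (Nat.cast_le.mpr (hord v))
  sketchSize_ge := by rwa [card_vertex hD hT, sketchSize_embedding]
  sketchSize_le := by rwa [card_vertex hD hT, sketchSize_embedding]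

end Alg

/-- The row sizes of an embedding of the class are bounded below in terms of the sketch size of the
algorithm. -/
lemma Embedding.InClass.exists_rowSize_ge {S VE EE : Type*} [Fintype VE] [Fintype EE]
    {F : Embedding S VE EE} {c₁ c₂ ε δ : ℝ} (hF : F.InClass c₁ c₂ ε δ) (hc₁ : 0 < c₁)
    (hc₂ : 0 < c₂) (hδ : 0 < δ) (hδ1 : δ < 1) {n m : ℝ}
    (hn : c₁ * scale ε δ n ≤ F.sketchSize) (hm : m ≤ c₂ * scale ε δ (3 * n - 2)) :
    ∃ ord : VE → ℕ, ∀ v, c₁ ^ 2 / (3 * c₂ ^ 2) * m ≤ F.rowSize ord v := by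
  obtain ⟨ord, -, hord⟩ := hF.accurate
  refine ⟨ord, fun v => le_trans ?_ (hord v)⟩
  have hκ : 0 ≤ Real.log (1 / δ) / ε ^ 2 :=
    div_nonneg (Real.log_nonneg ((one_le_div hδ).mpr hδ1.le)) (sq_nonneg ε)
  have hs : ∀ x, scale ε δ x = x * (Real.log (1 / δ) / ε ^ 2) := fun x => by
    rw [scale, mul_div_assoc]
  -- The lower bound on the sketch size forces the embedding to be large: c₁nκ ≤ c₂N_Eκ.
  have h₁ := hn.trans hF.sketchSize_le
  rw [hs] at h₁ hm ⊢
  rw [hs] at h₁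
  set κ := Real.log (1 / δ) / ε ^ 2
  -- The 3 comes from 3n − 2 ≤ 3n. Together with c₁N_Eκ ≥ (c₁²/c₂)nκ it yields the ratio c₁²/(3c₂²).
  have h₂ : m ≤ 3 * c₂ * (n * κ) := by
    refine hm.trans ?_
    nlinarith [mul_nonneg hc₂.le hκ]
  calc c₁ ^ 2 / (3 * c₂ ^ 2) * m ≤ c₁ ^ 2 / (3 * c₂ ^ 2) * (3 * c₂ * (n * κ)) := by gcongr
    _ = c₁ / c₂ * (c₁ * (n * κ)) := by field_simp
    _ ≤ c₁ / c₂ * (c₂ * (Fintype.card VE * κ)) := by gcongr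
    _ = c₁ * (Fintype.card VE * κ) := by field_simp

end

end TNSketch

/-! ### The theorem -/

open TNSketch in
theorem theorem4p2 (c₁ c₂ : ℝ) (hc₁ : 0 < c₁) (hc₂ : 0 < c₂) :
    ∃ C : ℝ, 0 < C ∧
      ∀ (V E S : Type*) [Fintype V] [Fintype E] [Fintype S] (D : DataNetwork V E S)
        (hD : Function.Surjective D.vertex)
        (T₀ : ContractionTree V), T₀.IsFull →
      ∀ ε δ : ℝ, 0 < ε → 0 < δ → δ < 1 →
      ∀ (m : ℕ) (hm : 0 < m),
        c₁ * scale ε δ (3 * Fintype.card S - 2) ≤ m →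
        m ≤ c₂ * scale ε δ (3 * Fintype.card S - 2) →
        (∀ s : S, m < D.size s) →
        (Alg.embedding D hD T₀ m hm).InClass c₁ c₂ ε δ ∧
        (Alg.embedding D hD T₀ m hm).sketchSize = m ∧
        (Alg.tree D hD T₀).IsFull ∧
        (Alg.tree D hD T₀).ConstrainedOn T₀ ∧
        ∀ (VE EE : Type*) [Fintype VE] [Fintype EE] (F : Embedding S VE EE),
          F.InClass c₁ c₂ ε δ →
          c₁ * scale ε δ (Fintype.card S) ≤ F.sketchSize →
          ∀ T : ContractionTree (V ⊕ VE), T.IsFull → T.ConstrainedOn T₀ →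
            (Alg.tree D hD T₀).cost (D.withEmbedding (Alg.embedding D hD T₀ m hm)) ≤
              C * T.cost (D.withEmbedding F) := by
  -- The ratio is capped at 1 so that higher powers of k are smaller and so that a sketched edge, of
  -- size above m, also has size at least km.
  obtain ⟨k, hk, hk1, hkc⟩ : ∃ k : ℝ, 0 < k ∧ k ≤ 1 ∧ k ≤ c₁ ^ 2 / (3 * c₂ ^ 2) :=
    ⟨min 1 (c₁ ^ 2 / (3 * c₂ ^ 2)), lt_min one_pos (by positivity), min_le_left _ _,
      min_le_right _ _⟩
  -- The stages cost at most 32/k³ times the cost of T_B: 8 per neighbourhood, with each contraction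
  -- in at most 4. The Kronecker contractions cost 4/k times it: 2 for a split output, and 2 since a
  -- contraction has two operands.
  refine ⟨32 / k ^ 3 + 4 / k, by positivity, ?_⟩
  intro V E S _ _ _ D hD T₀ hT₀ ε δ _ hδ hδ1 m hm h₁ h₂ hsize
  refine ⟨Alg.inClass_embedding D hD hm hT₀ h₁ h₂, Alg.sketchSize_embedding D hD hm,
    Alg.isFull_tree D hD T₀ hT₀, Alg.constrainedOn_treeAux D hD T₀ id, ?_⟩
  intro VE EE _ _ F hF hsketch T hT hcon
  obtain ⟨ord, hord⟩ := hF.exists_rowSize_ge hc₁ hc₂ hδ hδ1 hsketch h₂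
  have hrow : ∀ v, k * m ≤ F.rowSize ord v := fun v =>
    (mul_le_mul_of_nonneg_right hkc (Nat.cast_nonneg m)).trans (hord v)
  have : Nonempty V := ⟨T₀.verts_nonempty.choose⟩
  have hstage := DataNetwork.sum_stageCost_le hD hm hk hk1 hsize hrow hF.one_output hT hT₀ hcon
  have hleaf := DataNetwork.sum_leafCost_le hD hm hk hk1 hsize hrow hF.one_output hT hT₀.1
  rw [mul_comm, ← le_div_iff₀ (by positivity)] at hstage hleaf
  refine (Alg.cost_tree_le D hD hm hT₀.1).trans ?_
  calc _ ≤ 2 * (2 * T.cost (D.withEmbedding F) / k) +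
        32 * T.cost (D.withEmbedding F) / k ^ 3 := by gcongr
    _ = _ := by ring
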